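/- **Theorem 1.1.** Let $G$ be a finite generalized dihedral group generated by $A$ and $t$, i.e. $A$ is an abelian subgroup of index $2$ in the finite group $G$ and $t\in G\setminus A$ is an involution with $tat=a^{-1}$ for all $a\in A$. Let $S\subseteq G\setminus\{e\}$ be inverse-closed with $|S|=4$ and $t\in S$, and suppose that the Cayley graph $\Gamma=\mathrm{Cay}(G,S)$ (vertex set $G$, with $x,y$ adjacent when $yx^{-1}\in S$) is connected. A perfect code in $\Gamma$ is a set $D\subseteq G$ such that for every vertex $x$ there is exactly one vertex of $D$ that is equal or adjacent to $x$. For an integer $k$ let $\sigma(k)=(1-(-1)^k)/2$, and let $o(g)$ denote the order of $g$. Then $\Gamma$ admits a perfect code if and only if at least one of the following holds. 1. There are $s_0,s_1\in A$ such that $S=\{s_1,s_1^{-1},t,ts_0\}$ and, with $n=o(s_0)$ and $m$ the minimum positive integer such that $s_1^m\in\langle s_0\rangle$, one has $5\mid n$ and there is $u\in\{0,2,4,\ldots,2(n/5-1)\}$ such that $s_1^m=s_0^{5u/2+m}$ or $s_1^m=s_0^{5u/2-m}$. 2. There are $s_0,s_1,s_2\in A$ such that $S=\{t,ts_0,ts_1,ts_2\}$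 and, with $n=o(s_0)$, $m$ the minimum positive integer such that $s_1^m\in\langle s_0\rangle$, and $l$ the minimum positive integer such that $s_2^l\in\langle s_0,s_1\rangle$, one has $5\mid n$ and there are $v\in\{2,3,4\}$, integers $a,b$ with $\{a,b\}=\{2+\sigma(v),\,v-\sigma(v)-1\}$, $\alpha_1,\alpha_2\in\{0,1,\ldots,n/5-1\}$ and $j\in\{0,1,\ldots,m-1\}$ such that $$s_1^m=s_0^{5\alpha_1-am}\quad\text{and}\quad s_2^l=s_0^{5\alpha_2-bl+aj}s_1^j.$$ -/

import Mathlib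

/-- `G` is the generalized dihedral group generated by the abelian subgroup `A` of index two and
the involution `t` outside `A`, which inverts every element of `A`. -/
structure IsGeneralizedDihedral {G : Type*} [Group G] (A : Subgroup G) (t : G) : Prop where
  comm : ∀ a ∈ A, ∀ b ∈ A, a * b = b * a
  index_eq : A.index = 2
  not_mem : t ∉ A
  orderOf_eq : orderOf t = 2
  conj : ∀ a ∈ A, t * a * t = a⁻¹

/-- The Cayley graph `Cay(G, S)` of an inverse-closed set `S` not containing the identity:
`x` and `y` are adjacent when `y * x⁻¹ ∈ S`. -/
def cayleyGraph {G : Type*} [Group G] (S : Set G) (hone : (1 : G) ∉ S)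
    (hinv : ∀ s ∈ S, s⁻¹ ∈ S) : SimpleGraph G where
  Adj x y := y * x⁻¹ ∈ S
  symm := ⟨fun x y h => by
    have h' := hinv _ h
    rwa [mul_inv_rev, inv_inv] at h'⟩
  loopless := ⟨fun x h => hone (by rwa [mul_inv_cancel] at h)⟩

/-- A set `D` of vertices is a perfect code if every vertex is dominated by exactly one vertex
of `D`, where `u` dominates `v` if `u = v` or `u` and `v` are adjacent. -/
def IsPerfectCode {V : Type*} (Γ : SimpleGraph V) (D : Set V) : Prop :=
  ∀ v : V, ∃! u : V, u ∈ D ∧ (u = v ∨ Γ.Adj u v)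

/-- `σ(k) = (1 - (-1)^k) / 2`, that is, `0` for even `k` and `1` for odd `k`. -/
def parity (k : ℤ) : ℤ := (1 - (k.negOnePow : ℤ)) / 2

/-- `m` is the minimum positive integer such that `x ^ m ∈ H`. -/
def IsMinPowMem {G : Type*} [Group G] (x : G) (H : Subgroup G) (m : ℕ) : Prop :=
  IsLeast {k : ℕ | 0 < k ∧ x ^ k ∈ H} m

/-- `S = {s₁, s₁⁻¹, t, t s₀}` with `s₀, s₁ ∈ A`, where `n = o(s₀)` is divisible by `5` and
`s₁ ^ m = s₀ ^ (5u/2 ± m)` for some `u ∈ {0, 2, 4, …, 2(n/5 - 1)}`. -/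
def FirstFamily {G : Type*} [Group G] (A : Subgroup G) (t : G) (S : Set G) : Prop :=
  ∃ s₀ ∈ A, ∃ s₁ ∈ A, ∃ n m : ℕ,
    S = {s₁, s₁⁻¹, t, t * s₀} ∧
    orderOf s₀ = n ∧
    IsMinPowMem s₁ (Subgroup.zpowers s₀) m ∧
    5 ∣ n ∧
    ∃ u : ℤ, 0 ≤ u ∧ u ≤ 2 * ((n : ℤ) / 5 - 1) ∧ Even u ∧
      (s₁ ^ m = s₀ ^ (5 * u / 2 + m) ∨ s₁ ^ m = s₀ ^ (5 * u / 2 - m))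

/-- `S = {t, t s₀, t s₁, t s₂}` with `s₀, s₁, s₂ ∈ A`, where `n = o(s₀)` is divisible by `5`,
`s₁ ^ m = s₀ ^ (5α₁ - am)` and `s₂ ^ l = s₀ ^ (5α₂ - bl + aj) s₁ ^ j`, and
`{a, b} = {2 + σ(v), v - σ(v) - 1}` for some `v ∈ {2, 3, 4}`. -/
def SecondFamily {G : Type*} [Group G] (A : Subgroup G) (t : G) (S : Set G) : Prop :=
  ∃ s₀ ∈ A, ∃ s₁ ∈ A, ∃ s₂ ∈ A, ∃ n m l : ℕ,
    S = {t, t * s₀, t * s₁, t * s₂} ∧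
    orderOf s₀ = n ∧
    IsMinPowMem s₁ (Subgroup.zpowers s₀) m ∧
    IsMinPowMem s₂ (Subgroup.closure {s₀, s₁}) l ∧
    5 ∣ n ∧
    ∃ v ∈ ({2, 3, 4} : Set ℤ), ∃ a b : ℤ,
      ({a, b} : Set ℤ) = {2 + parity v, v - parity v - 1} ∧
      ∃ α₁ α₂ j : ℤ,
        (0 ≤ α₁ ∧ α₁ ≤ (n : ℤ) / 5 - 1) ∧
        (0 ≤ α₂ ∧ α₂ ≤ (n : ℤ) / 5 - 1) ∧
        (0 ≤ j ∧ j ≤ (m : ℤ) - 1) ∧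
        s₁ ^ m = s₀ ^ (5 * α₁ - a * m) ∧
        s₂ ^ l = s₀ ^ (5 * α₂ - b * l + a * j) * s₁ ^ j

/-- `f` and `g` are the indicator functions of the two halves of a perfect code in the bipartite
graph on two copies of `B`, in which `a` in the first copy is joined to `a + c` in the second one
for the four labels `c = w, x, y, z`. -/
structure IsBipartiteCode {B : Type*} [AddCommGroup B] (f g : B → ℕ) (w x y z : B) : Prop where
  left : ∀ a, f a + g (a + w) + g (a + x) + g (a + y) + g (a + z) = 1
  right : ∀ a, g a + f (a - w) + f (a - x) + f (a - y) + f (a - z) = 1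

/-- The point `a` of the code, in the first copy, sees the code points at distance three arranged
according to the cyclic order `w → x → y → z → w` of the labels. -/
structure IsCyclicAt {B : Type*} [AddCommGroup B] (f g : B → ℕ) (w x y z a : B) : Prop where
  self : f a = 1
  dw : g (a + x + x - w) = 1
  dx : g (a + y + y - x) = 1
  dy : g (a + z + z - y) = 1
  dz : g (a + w + w - z) = 1
  sw : g (a + y + z - w) = 1
  sx : g (a + z + w - x) = 1
  sy : g (a + w + x - y) = 1
  sz : g (a + x + y - z) = 1

/-! ### Codes in the bipartite graph on two copies of an abelian group -/

section BipartiteCode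

variable {B : Type*} [AddCommGroup B] {f g : B → ℕ} {w x y z a : B}

theorem IsBipartiteCode.swap (h : IsBipartiteCode f g w x y z) :
    IsBipartiteCode g f (-w) (-x) (-y) (-z) where
  left a := by simpa only [sub_eq_add_neg] using h.right a
  right a := by simpa only [sub_neg_eq_add] using h.left a

theorem IsBipartiteCode.rotate (h : IsBipartiteCode f g w x y z) :
    IsBipartiteCode f g x y z w where
  left a := by have := h.left a; omega
  right a := by have := h.right a; omega

theorem IsCyclicAt.rotate (h : IsCyclicAt f g w x y z a) : IsCyclicAt f g x y z w a where
  self := h.self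
  dw := h.dx
  dx := h.dy
  dy := h.dz
  dz := h.dw
  sw := h.sx
  sx := h.sy
  sy := h.sz
  sz := h.sw

/-- Among three points in a row of a code, an odd number is doubled. -/
theorem exists_doubled {T₁ T₂ T₃ U₁₂ U₁₃ U₂₃ : ℕ} (h₁ : T₁ + U₁₂ + U₁₃ = 1)
    (h₂ : T₂ + U₁₂ + U₂₃ = 1) (h₃ : T₃ + U₁₃ + U₂₃ = 1) : T₁ = 1 ∨ T₂ = 1 ∨ T₃ = 1 := by
  omega

/-- A derangement of four points, given by its graph `T`, is a four-cycle or a double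
transposition. -/
theorem four_cycle_of_derangement {T₁₂ T₁₃ T₁₄ T₂₁ T₂₃ T₂₄ T₃₁ T₃₂ T₃₄ T₄₁ T₄₂ T₄₃ : ℕ}
    (r₁ : T₁₂ = 1 ∨ T₁₃ = 1 ∨ T₁₄ = 1) (r₂ : T₂₁ = 1 ∨ T₂₃ = 1 ∨ T₂₄ = 1)
    (r₃ : T₃₁ = 1 ∨ T₃₂ = 1 ∨ T₃₄ = 1) (r₄ : T₄₁ = 1 ∨ T₄₂ = 1 ∨ T₄₃ = 1)
    (c₁ : T₂₁ + T₃₁ ≤ 1 ∧ T₂₁ + T₄₁ ≤ 1 ∧ T₃₁ + T₄₁ ≤ 1)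
    (c₂ : T₁₂ + T₃₂ ≤ 1 ∧ T₁₂ + T₄₂ ≤ 1 ∧ T₃₂ + T₄₂ ≤ 1)
    (c₃ : T₁₃ + T₂₃ ≤ 1 ∧ T₁₃ + T₄₃ ≤ 1 ∧ T₂₃ + T₄₃ ≤ 1)
    (c₄ : T₁₄ + T₂₄ ≤ 1 ∧ T₁₄ + T₃₄ ≤ 1 ∧ T₂₄ + T₃₄ ≤ 1)
    (n₂ : T₁₂ = 1 → T₂₁ = 1 → T₃₄ = 1 → T₄₃ = 1 → False)
    (n₃ : T₁₃ = 1 → T₃₁ = 1 → T₂₄ = 1 → T₄₂ = 1 → False)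
    (n₄ : T₁₄ = 1 → T₄₁ = 1 → T₂₃ = 1 → T₃₂ = 1 → False) :
    (T₁₂ = 1 ∧ T₂₃ = 1 ∧ T₃₄ = 1 ∧ T₄₁ = 1) ∨ (T₁₂ = 1 ∧ T₂₄ = 1 ∧ T₄₃ = 1 ∧ T₃₁ = 1) ∨
    (T₁₃ = 1 ∧ T₃₂ = 1 ∧ T₂₄ = 1 ∧ T₄₁ = 1) ∨ (T₁₃ = 1 ∧ T₃₄ = 1 ∧ T₄₂ = 1 ∧ T₂₁ = 1) ∨
    (T₁₄ = 1 ∧ T₄₂ = 1 ∧ T₂₃ = 1 ∧ T₃₁ = 1) ∨ (T₁₄ = 1 ∧ T₄₃ = 1 ∧ T₃₂ = 1 ∧ T₂₁ = 1) := by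
  obtain ⟨a₁, b₁, d₁⟩ := c₁
  obtain ⟨a₂, b₂, d₂⟩ := c₂
  obtain ⟨a₃, b₃, d₃⟩ := c₃
  obtain ⟨a₄, b₄, d₄⟩ := c₄
  rcases r₁ with r₁ | r₁ | r₁ <;> rcases r₂ with r₂ | r₂ | r₂ <;>
    rcases r₃ with r₃ | r₃ | r₃ <;> rcases r₄ with r₄ | r₄ | r₄ <;>
    first
    | exact (n₂ ‹_› ‹_› ‹_› ‹_›).elim
    | exact (n₃ ‹_› ‹_› ‹_› ‹_›).elim
    | exact (n₄ ‹_› ‹_› ‹_› ‹_›).elim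
    | (simp only [r₁, r₂, r₃, r₄, and_self, true_or, or_true]; done)
    | (exfalso; clear n₂ n₃ n₄; omega)

/-- The possible arrangements of the code points at distance three from a point of the code
in the graph with vertices in `ℤ⁴`: a double transposition cannot occur. -/
theorem exists_cycle_of_lattice_code {F G : ℤ → ℤ → ℤ → ℤ → ℕ}
    (hF : ∀ p q r s, F p q r s + G (p + 1) q r s + G p (q + 1) r s + G p q (r + 1) s
      + G p q r (s + 1) = 1)
    (hG : ∀ p q r s, G p q r s + F (p - 1) q r s + F p (q - 1) r s + F p q (r - 1) s
      + F p q r (s - 1) = 1) (h0 : F 0 0 0 0 = 1) :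
    (G (-1) 2 0 0 = 1 ∧ G 0 (-1) 2 0 = 1 ∧ G 0 0 (-1) 2 = 1 ∧ G 2 0 0 (-1) = 1) ∨
    (G (-1) 2 0 0 = 1 ∧ G 0 (-1) 0 2 = 1 ∧ G 0 0 2 (-1) = 1 ∧ G 2 0 (-1) 0 = 1) ∨
    (G (-1) 0 2 0 = 1 ∧ G 0 2 (-1) 0 = 1 ∧ G 0 (-1) 0 2 = 1 ∧ G 2 0 0 (-1) = 1) ∨
    (G (-1) 0 2 0 = 1 ∧ G 0 0 (-1) 2 = 1 ∧ G 0 2 0 (-1) = 1 ∧ G 2 (-1) 0 0 = 1) ∨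
    (G (-1) 0 0 2 = 1 ∧ G 0 2 0 (-1) = 1 ∧ G 0 (-1) 2 0 = 1 ∧ G 2 0 (-1) 0 = 1) ∨
    (G (-1) 0 0 2 = 1 ∧ G 0 0 2 (-1) = 1 ∧ G 0 2 (-1) 0 = 1 ∧ G 2 (-1) 0 0 = 1) := by
  have g0 := hF 0 0 0 0
  have g1 := hG 1 0 0 0
  have g2 := hG 0 1 0 0
  have g3 := hG 0 0 1 0
  have g4 := hG 0 0 0 1
  norm_num [h0] at g0 g1 g2 g3 g4
  -- The vertex `e₂ - e₁` is at distance two from the code point `0`, which excludes both it and its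
  -- neighbour `e₂` from the code. One of its three other neighbours is therefore in the code; the
  -- same holds for every `eᵢ - eⱼ`.
  have e21 : G (-1) 2 0 0 + G (-1) 1 1 0 + G (-1) 1 0 1 = 1 := by
    have := hF (-1) 1 0 0
    norm_num at this
    omega
  have e31 : G (-1) 0 2 0 + G (-1) 1 1 0 + G (-1) 0 1 1 = 1 := by
    have := hF (-1) 0 1 0
    norm_num at this
    omega
  have e41 : G (-1) 0 0 2 + G (-1) 1 0 1 + G (-1) 0 1 1 = 1 := by
    have := hF (-1) 0 0 1
    norm_num at this
    omega
  have e12 : G 2 (-1) 0 0 + G 1 (-1) 1 0 + G 1 (-1) 0 1 = 1 := by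
    have := hF 1 (-1) 0 0
    norm_num at this
    omega
  have e32 : G 0 (-1) 2 0 + G 1 (-1) 1 0 + G 0 (-1) 1 1 = 1 := by
    have := hF 0 (-1) 1 0
    norm_num at this
    omega
  have e42 : G 0 (-1) 0 2 + G 1 (-1) 0 1 + G 0 (-1) 1 1 = 1 := by
    have := hF 0 (-1) 0 1
    norm_num at this
    omega
  have e13 : G 2 0 (-1) 0 + G 1 1 (-1) 0 + G 1 0 (-1) 1 = 1 := by
    have := hF 1 0 (-1) 0
    norm_num at this
    omega
  have e23 : G 0 2 (-1) 0 + G 1 1 (-1) 0 + G 0 1 (-1) 1 = 1 := by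
    have := hF 0 1 (-1) 0
    norm_num at this
    omega
  have e43 : G 0 0 (-1) 2 + G 1 0 (-1) 1 + G 0 1 (-1) 1 = 1 := by
    have := hF 0 0 (-1) 1
    norm_num at this
    omega
  have e14 : G 2 0 0 (-1) + G 1 1 0 (-1) + G 1 0 1 (-1) = 1 := by
    have := hF 1 0 0 (-1)
    norm_num at this
    omega
  have e24 : G 0 2 0 (-1) + G 1 1 0 (-1) + G 0 1 1 (-1) = 1 := by
    have := hF 0 1 0 (-1)
    norm_num at this
    omega
  have e34 : G 0 0 2 (-1) + G 1 0 1 (-1) + G 0 1 1 (-1) = 1 := by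
    have := hF 0 0 1 (-1)
    norm_num at this
    omega
  -- The vertices `2e₁ - e₂` and `2e₁ - e₃` share the neighbour `2e₁ - e₂ - e₃`, so the code
  -- contains at most one of them. Hence the assignment of a doubled `eᵢ` to each subtracted `eⱼ` is
  -- injective.
  have c123 : G 2 (-1) 0 0 + G 2 0 (-1) 0 ≤ 1 := by
    have := hF 2 (-1) (-1) 0
    norm_num at this
    omega
  have c124 : G 2 (-1) 0 0 + G 2 0 0 (-1) ≤ 1 := by
    have := hF 2 (-1) 0 (-1)
    norm_num at this
    omega
  have c134 : G 2 0 (-1) 0 + G 2 0 0 (-1) ≤ 1 := by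
    have := hF 2 0 (-1) (-1)
    norm_num at this
    omega
  have c213 : G (-1) 2 0 0 + G 0 2 (-1) 0 ≤ 1 := by
    have := hF (-1) 2 (-1) 0
    norm_num at this
    omega
  have c214 : G (-1) 2 0 0 + G 0 2 0 (-1) ≤ 1 := by
    have := hF (-1) 2 0 (-1)
    norm_num at this
    omega
  have c234 : G 0 2 (-1) 0 + G 0 2 0 (-1) ≤ 1 := by
    have := hF 0 2 (-1) (-1)
    norm_num at this
    omega
  have c312 : G (-1) 0 2 0 + G 0 (-1) 2 0 ≤ 1 := by
    have := hF (-1) (-1) 2 0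
    norm_num at this
    omega
  have c314 : G (-1) 0 2 0 + G 0 0 2 (-1) ≤ 1 := by
    have := hF (-1) 0 2 (-1)
    norm_num at this
    omega
  have c324 : G 0 (-1) 2 0 + G 0 0 2 (-1) ≤ 1 := by
    have := hF 0 (-1) 2 (-1)
    norm_num at this
    omega
  have c412 : G (-1) 0 0 2 + G 0 (-1) 0 2 ≤ 1 := by
    have := hF (-1) (-1) 0 2
    norm_num at this
    omega
  have c413 : G (-1) 0 0 2 + G 0 0 (-1) 2 ≤ 1 := by
    have := hF (-1) 0 (-1) 2
    norm_num at this
    omega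
  have c423 : G 0 (-1) 0 2 + G 0 0 (-1) 2 ≤ 1 := by
    have := hF 0 (-1) (-1) 2
    norm_num at this
    omega
  have s12 : G 1 1 (-1) 0 + G 1 1 0 (-1) ≤ 1 := by
    have := hF 1 1 (-1) (-1)
    norm_num at this
    omega
  have s13 : G 1 (-1) 1 0 + G 1 0 1 (-1) ≤ 1 := by
    have := hF 1 (-1) 1 (-1)
    norm_num at this
    omega
  have s14 : G 1 (-1) 0 1 + G 1 0 (-1) 1 ≤ 1 := by
    have := hF 1 (-1) (-1) 1
    norm_num at this
    omega
  have s23 : G (-1) 1 1 0 + G 0 1 1 (-1) ≤ 1 := by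
    have := hF (-1) 1 1 (-1)
    norm_num at this
    omega
  have s24 : G (-1) 1 0 1 + G 0 1 (-1) 1 ≤ 1 := by
    have := hF (-1) 1 (-1) 1
    norm_num at this
    omega
  have s34 : G (-1) 0 1 1 + G 0 (-1) 1 1 ≤ 1 := by
    have := hF (-1) (-1) 1 1
    norm_num at this
    omega
  clear hF hG g0 g1 g2 g3 g4
  refine four_cycle_of_derangement
    (exists_doubled e21 e31 e41)
    (exists_doubled e12 e32 e42)
    (exists_doubled e13 e23 e43)
    (exists_doubled e14 e24 e34)
    ⟨c123, c124, c134⟩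
    ⟨c213, c214, c234⟩
    ⟨c312, c314, c324⟩
    ⟨c412, c413, c423⟩
    ?_ ?_ ?_
  -- For the double transposition `(12)(34)`, the dominators of `e₃ - e₁` and `e₃ - e₂` are forced
  -- to be `e₃ + e₄ - e₁` and `e₃ + e₄ - e₂`, which share a neighbour.
  · intro h₁ h₂ h₃ h₄
    clear * - h₁ h₂ h₃ h₄ c314 c324 e21 e12 e31 e32 s34
    omega
  · intro h₁ h₂ h₃ h₄
    clear * - h₁ h₂ h₃ h₄ c214 c234 e31 e13 e21 e23 s24
    omega
  · intro h₁ h₂ h₃ h₄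
    clear * - h₁ h₂ h₃ h₄ c213 c234 e41 e14 e21 e24 s23
    omega

/-- A code point at `a + 2x - w` and one at `a + 2z - y` force one at `a + y + z - w`. -/
theorem IsBipartiteCode.apply_sum_eq_one (h : IsBipartiteCode f g w x y z) (ha : f a = 1)
    (hw : g (a + x + x - w) = 1) (hy : g (a + z + z - y) = 1) : g (a + y + z - w) = 1 := by
  -- The vertex `a + z - w` must be dominated. The code points `a`, `a + 2x - w` and `a + 2z - y`
  -- rule out all candidates except `a + y + z - w`.
  have h₀ := h.left a
  have h₁ := h.right (a + z)
  have h₂ := h.left (a + z - w)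
  have h₃ := h.left (a + x - w)
  have h₄ := h.left (a + z + z - w - y)
  rw [show a + z - z = a by abel] at h₁
  rw [show a + z - w + w = a + z by abel, show a + z - w + y = a + y + z - w by abel,
    show a + z - w + z = a + z + z - w by abel, show a + z - w + x = a + x + z - w by abel] at h₂
  rw [show a + x - w + x = a + x + x - w by abel,
    show a + x - w + z = a + x + z - w by abel] at h₃
  rw [show a + z + z - w - y + w = a + z + z - y by abel,
    show a + z + z - w - y + y = a + z + z - w by abel] at h₄
  omega

theorem IsBipartiteCode.isCyclicAt (h : IsBipartiteCode f g w x y z) (ha : f a = 1)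
    (hw : g (a + x + x - w) = 1) (hx : g (a + y + y - x) = 1) (hy : g (a + z + z - y) = 1)
    (hz : g (a + w + w - z) = 1) : IsCyclicAt f g w x y z a where
  self := ha
  dw := hw
  dx := hx
  dy := hy
  dz := hz
  sw := h.apply_sum_eq_one ha hw hy
  sx := h.rotate.apply_sum_eq_one ha hx hz
  sy := h.rotate.rotate.apply_sum_eq_one ha hy hw
  sz := h.rotate.rotate.rotate.apply_sum_eq_one ha hz hx

theorem IsBipartiteCode.perm₂₃ (h : IsBipartiteCode f g w x y z) :
    IsBipartiteCode f g w y x z where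
  left a := by have := h.left a; omega
  right a := by have := h.right a; omega

theorem IsBipartiteCode.perm₃₄ (h : IsBipartiteCode f g w x y z) :
    IsBipartiteCode f g w x z y where
  left a := by have := h.left a; omega
  right a := by have := h.right a; omega

/-- The code points around a point of the code are arranged according to a cyclic order
of the labels. -/
theorem IsBipartiteCode.exists_isCyclicAt (h : IsBipartiteCode f g w x y z) (ha : f a = 1) :
    IsCyclicAt f g w x y z a ∨ IsCyclicAt f g w x z y a ∨ IsCyclicAt f g w y x z a ∨
      IsCyclicAt f g w y z x a ∨ IsCyclicAt f g w z x y a ∨ IsCyclicAt f g w z y x a := by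
  -- The lattice maps to `B` with origin at `a`. The code equations hold there whatever relations
  -- the labels satisfy in `B`.
  have key := exists_cycle_of_lattice_code
    (F := fun p q r s => f (a + p • w + q • x + r • y + s • z))
    (G := fun p q r s => g (a + p • w + q • x + r • y + s • z)) ?_ ?_ ?_
  · have e : ∀ b c : B, a + b + b - c = a + (2 : ℤ) • b + (-1 : ℤ) • c := fun b c => by module
    simp only [zero_smul, add_zero] at key
    rcases key with ⟨k₁, k₂, k₃, k₄⟩ | ⟨k₁, k₂, k₃, k₄⟩ | ⟨k₁, k₂, k₃, k₄⟩ |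
      ⟨k₁, k₂, k₃, k₄⟩ | ⟨k₁, k₂, k₃, k₄⟩ | ⟨k₁, k₂, k₃, k₄⟩
    · refine Or.inl (h.isCyclicAt ha ?_ ?_ ?_ ?_) <;> rw [e] <;>
        first | assumption | (rw [add_right_comm]; assumption)
    · refine Or.inr (Or.inl (h.perm₃₄.isCyclicAt ha ?_ ?_ ?_ ?_)) <;> rw [e] <;>
        first | assumption | (rw [add_right_comm]; assumption)
    · refine Or.inr (Or.inr (Or.inl (h.perm₂₃.isCyclicAt ha ?_ ?_ ?_ ?_))) <;> rw [e] <;>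
        first | assumption | (rw [add_right_comm]; assumption)
    · refine Or.inr (Or.inr (Or.inr (Or.inl (h.perm₂₃.perm₃₄.isCyclicAt ha ?_ ?_ ?_ ?_)))) <;>
        rw [e] <;> first | assumption | (rw [add_right_comm]; assumption)
    · refine Or.inr (Or.inr (Or.inr (Or.inr (Or.inl
        (h.perm₃₄.perm₂₃.isCyclicAt ha ?_ ?_ ?_ ?_))))) <;>
        rw [e] <;> first | assumption | (rw [add_right_comm]; assumption)
    · refine Or.inr (Or.inr (Or.inr (Or.inr (Or.inr
        (h.perm₃₄.perm₂₃.perm₃₄.isCyclicAt ha ?_ ?_ ?_ ?_))))) <;>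
        rw [e] <;> first | assumption | (rw [add_right_comm]; assumption)
  · intro p q r s
    have := h.left (a + p • w + q • x + r • y + s • z)
    rwa [show a + p • w + q • x + r • y + s • z + w = a + (p + 1) • w + q • x + r • y + s • z by
        module,
      show a + p • w + q • x + r • y + s • z + x = a + p • w + (q + 1) • x + r • y + s • z by
        module,
      show a + p • w + q • x + r • y + s • z + y = a + p • w + q • x + (r + 1) • y + s • z by
        module,
      show a + p • w + q • x + r • y + s • z + z = a + p • w + q • x + r • y + (s + 1) • z by
        module] at this
  · intro p q r s
    have := h.right (a + p • w + q • x + r • y + s • z)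
    rwa [show a + p • w + q • x + r • y + s • z - w = a + (p - 1) • w + q • x + r • y + s • z by
        module,
      show a + p • w + q • x + r • y + s • z - x = a + p • w + (q - 1) • x + r • y + s • z by
        module,
      show a + p • w + q • x + r • y + s • z - y = a + p • w + q • x + (r - 1) • y + s • z by
        module,
      show a + p • w + q • x + r • y + s • z - z = a + p • w + q • x + r • y + (s - 1) • z by
        module] at this
  · simpa using ha

/-- The cyclic order at a point of the code agrees with the one at the code points at distance
three. -/
theorem IsBipartiteCode.isCyclicAt_double (h : IsBipartiteCode f g w x y z)
    (ha : IsCyclicAt f g w x y z a) :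
    IsCyclicAt g f (-w) (-x) (-y) (-z) (a + x + x - w) := by
  rcases h.swap.exists_isCyclicAt ha.dw with c | c | c | c | c | c
  · exact c
  -- The order `w → x → z → y` would put a code point at `a + x + y - z - w`, adjacent to the one at
  -- `a + x + y - z`.
  · have k := h.left (a + x - w + y - z)
    have k₁ := c.sz
    rw [show a + x + x - w + -x + -z - -y = a + x - w + y - z by abel] at k₁
    rw [show a + x - w + y - z + w = a + x + y - z by abel] at k
    have := ha.sz
    omega
  -- The remaining orders put a code point at `a + x - z` or `a + x - y`, sharing the neighbour `a +
  -- x` with `a`.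
  all_goals
    exfalso
    have c₁ := c.sw
    first
    | (rw [show a + x + x - w + -x + -z - -w = a + x - z by abel] at c₁)
    | (rw [show a + x + x - w + -z + -x - -w = a + x - z by abel] at c₁)
    | (rw [show a + x + x - w + -x + -y - -w = a + x - y by abel] at c₁)
    | (rw [show a + x + x - w + -y + -x - -w = a + x - y by abel] at c₁)
    have k := h.swap.left (a + x)
    rw [show a + x + -x = a by abel, ← sub_eq_add_neg, ← sub_eq_add_neg, ← sub_eq_add_neg] at k
    have := ha.self
    omega

/-- Any other order at this second kind of code point would create a code point adjacent to `a + x +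
y - z`, or one at distance two from `a`. -/
theorem IsBipartiteCode.isCyclicAt_sum (h : IsBipartiteCode f g w x y z)
    (ha : IsCyclicAt f g w x y z a) :
    IsCyclicAt g f (-w) (-x) (-y) (-z) (a + y + z - w) := by
  have ky := h.swap.left (a + y)
  have kz := h.swap.left (a + z)
  rw [show a + y + -y = a by abel, ← sub_eq_add_neg, ← sub_eq_add_neg, ← sub_eq_add_neg] at ky
  rw [show a + z + -z = a by abel, ← sub_eq_add_neg, ← sub_eq_add_neg, ← sub_eq_add_neg] at kz
  have ha₁ := ha.self
  rcases h.swap.exists_isCyclicAt ha.sw with c | c | c | c | c | c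
  · exact c
  · have k := h.left (a + x + y - z - w)
    have k₁ := c.dx
    rw [show a + y + z - w + -z + -z - -x = a + x + y - z - w by abel] at k₁
    rw [show a + x + y - z - w + w = a + x + y - z by abel] at k
    have := ha.sz
    omega
  · have c₁ := c.dw
    rw [show a + y + z - w + -y + -y - -w = a + z - y by abel] at c₁
    omega
  · have c₁ := c.dw
    rw [show a + y + z - w + -y + -y - -w = a + z - y by abel] at c₁
    omega
  · have c₁ := c.dw
    rw [show a + y + z - w + -z + -z - -w = a + y - z by abel] at c₁
    omega
  · have c₁ := c.dw
    rw [show a + y + z - w + -z + -z - -w = a + y - z by abel] at c₁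
    omega

/-- The point of the code that dominates `a` sees the cyclic order `w → x → y → z → w`, and its
weight, computed from the weight `k` of `a` and the weights `1, 3, 4, 2` of the labels, is
divisible by five. -/
def IsWeightAt (f g : B → ℕ) (w x y z a : B) (k : ℤ) : Prop :=
  (IsCyclicAt f g w x y z a ∧ 5 ∣ k) ∨
  (IsCyclicAt g f (-w) (-x) (-y) (-z) (a + w) ∧ 5 ∣ k + 1) ∨
  (IsCyclicAt g f (-w) (-x) (-y) (-z) (a + x) ∧ 5 ∣ k + 3) ∨
  (IsCyclicAt g f (-w) (-x) (-y) (-z) (a + y) ∧ 5 ∣ k + 4) ∨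
  (IsCyclicAt g f (-w) (-x) (-y) (-z) (a + z) ∧ 5 ∣ k + 2)

theorem IsWeightAt.congr {k l : ℤ} (h : IsWeightAt f g w x y z a k) (hkl : 5 ∣ k - l) :
    IsWeightAt f g w x y z a l := by
  rcases h with ⟨c, d⟩ | ⟨c, d⟩ | ⟨c, d⟩ | ⟨c, d⟩ | ⟨c, d⟩
  · exact Or.inl ⟨c, by omega⟩
  · exact Or.inr (Or.inl ⟨c, by omega⟩)
  · exact Or.inr (Or.inr (Or.inl ⟨c, by omega⟩))
  · exact Or.inr (Or.inr (Or.inr (Or.inl ⟨c, by omega⟩)))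
  · exact Or.inr (Or.inr (Or.inr (Or.inr ⟨c, by omega⟩)))

/-- Multiplication by `2` modulo five carries the weights `3, 4, 2, 1` of `x, y, z, w` to `1, 3, 4,
2`, so rotating the labels doubles the weight. -/
theorem IsWeightAt.rotate {k : ℤ} (h : IsWeightAt f g w x y z a k) :
    IsWeightAt f g x y z w a (2 * k) := by
  rcases h with ⟨c, d⟩ | ⟨c, d⟩ | ⟨c, d⟩ | ⟨c, d⟩ | ⟨c, d⟩
  · exact Or.inl ⟨c.rotate, by omega⟩
  · exact Or.inr (Or.inr (Or.inr (Or.inr ⟨c.rotate, by omega⟩)))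
  · exact Or.inr (Or.inl ⟨c.rotate, by omega⟩)
  · exact Or.inr (Or.inr (Or.inl ⟨c.rotate, by omega⟩))
  · exact Or.inr (Or.inr (Or.inr (Or.inl ⟨c.rotate, by omega⟩)))

/-- The dominator of `a + w` is either that of `a` or a code point at distance three from it,
located by the cyclic order; the label weights are chosen so that the congruences match. The sign is
due to the labels being negated in the other copy. -/
theorem IsBipartiteCode.isWeightAt_add (h : IsBipartiteCode f g w x y z) {k : ℤ}
    (ha : IsWeightAt f g w x y z a k) :
    IsWeightAt g f (-w) (-x) (-y) (-z) (a + w) (-(k + 1)) := by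
  rcases ha with ⟨c, d⟩ | ⟨c, d⟩ | ⟨c, d⟩ | ⟨c, d⟩ | ⟨c, d⟩
  · refine Or.inr (Or.inl ⟨?_, by omega⟩)
    simpa using c
  · exact Or.inl ⟨c, by omega⟩
  · refine Or.inr (Or.inr (Or.inl ⟨?_, by omega⟩))
    have := h.swap.isCyclicAt_double c
    rwa [show a + x + -x + -x - -w = a + w + -x by abel] at this
  · refine Or.inr (Or.inr (Or.inr (Or.inr ⟨?_, by omega⟩)))
    have := h.swap.isCyclicAt_sum c
    rwa [show a + y + -y + -z - -w = a + w + -z by abel] at this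
  · refine Or.inr (Or.inr (Or.inr (Or.inl ⟨?_, by omega⟩)))
    have := h.swap.isCyclicAt_sum c
    rwa [show a + z + -y + -z - -w = a + w + -y by abel] at this

theorem IsBipartiteCode.isWeightAt_add_second (h : IsBipartiteCode f g w x y z) {k : ℤ}
    (ha : IsWeightAt f g w x y z a k) :
    IsWeightAt g f (-w) (-x) (-y) (-z) (a + x) (-(k + 3)) :=
  -- Four rotations restore the labels, and `8 * -(2k + 1) ≡ -(k + 3)` modulo five.
  (h.rotate.isWeightAt_add ha.rotate).rotate.rotate.rotate.congr (by omega)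

theorem IsBipartiteCode.isWeightAt_add_sub (h : IsBipartiteCode f g w x y z) {k : ℤ}
    (ha : IsWeightAt f g w x y z a k) : IsWeightAt f g w x y z (a + (x - w)) (k + 2) := by
  have := h.swap.isWeightAt_add (h.isWeightAt_add_second ha)
  simp only [neg_neg] at this
  rw [show a + x + -w = a + (x - w) by abel] at this
  exact this.congr (by omega)

theorem IsBipartiteCode.isWeightAt_sub_sub (h : IsBipartiteCode f g w x y z) {k : ℤ}
    (ha : IsWeightAt f g w x y z a k) : IsWeightAt f g w x y z (a - (x - w)) (k - 2) := by
  have := h.swap.isWeightAt_add_second (h.isWeightAt_add ha)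
  simp only [neg_neg] at this
  rw [show a + w + -x = a - (x - w) by abel] at this
  exact this.congr (by omega)

theorem IsBipartiteCode.isWeightAt_add_zsmul (h : IsBipartiteCode f g w x y z) {k : ℤ}
    (ha : IsWeightAt f g w x y z a k) (i : ℤ) :
    IsWeightAt f g w x y z (a + i • (x - w)) (k + 2 * i) := by
  induction i with
  | zero => simpa using ha
  | succ i ih =>
    have := h.isWeightAt_add_sub ih
    rw [add_assoc, ← add_one_zsmul] at this
    exact this.congr (by omega)
  | pred i ih =>
    have := h.isWeightAt_sub_sub ih
    rw [show a + (-i : ℤ) • (x - w) - (x - w) = a + (-i - 1 : ℤ) • (x - w) by module] at this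
    exact this.congr (by omega)

/-- A relation between the differences of the labels of a code yields a relation modulo five. -/
theorem IsBipartiteCode.five_dvd_of_relation (h : IsBipartiteCode f g w x y z)
    (ha : IsCyclicAt f g w x y z a) {i j l : ℤ}
    (hijl : i • (x - w) + j • (y - w) + l • (z - w) = 0) : 5 ∣ 2 * i + 3 * j + l := by
  -- `y - w = (x - w) + (y - x)` and `z - w = (z - y) + (y - x) + (x - w)`
  have h₁ := h.isWeightAt_add_zsmul (Or.inl ⟨ha, dvd_zero 5⟩) (i + j + l)
  have h₂ := h.rotate.isWeightAt_add_zsmul h₁.rotate (j + l)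
  have h₃ := h.rotate.rotate.isWeightAt_add_zsmul h₂.rotate l
  rw [show a + (i + j + l) • (x - w) + (j + l) • (y - x) + l • (z - y) =
    a + (i • (x - w) + j • (y - w) + l • (z - w)) by module, hijl, add_zero] at h₃
  have k := h.left a
  have k₀ := ha.self
  -- The walk has returned to `a`, which dominates itself, so only the first alternative survives.
  -- The two rotations make the weight `8(i + j + l) + 4(j + l) + 2l`, congruent to `4(2i + 3j +
  -- l)`.
  rcases h₃ with ⟨c, d⟩ | ⟨c, d⟩ | ⟨c, d⟩ | ⟨c, d⟩ | ⟨c, d⟩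
  · omega
  all_goals
    have := c.self
    omega

end BipartiteCode

/-! ### Perfect codes of the square grid -/

/-- The five values of `F` on the closed neighbourhood of a point of the square grid sum to one. -/
def IsGridCode (F : ℤ → ℤ → ℕ) : Prop :=
  ∀ i j, F i j + F (i + 1) j + F (i - 1) j + F i (j + 1) + F i (j - 1) = 1

/-- The point `(i, j)` of the code sees the code points at distance three at the knight moves
`±(2, e), ±(e, -2)`. -/
def IsChiralAt (F : ℤ → ℤ → ℕ) (e i j : ℤ) : Prop :=
  F i j = 1 ∧ F (i + 2) (j + e) = 1 ∧ F (i - 2) (j - e) = 1 ∧ F (i + e) (j - 2) = 1 ∧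
    F (i - e) (j + 2) = 1

section GridCode

variable {F : ℤ → ℤ → ℕ}

theorem IsGridCode.reflect (h : IsGridCode F) : IsGridCode fun i j => F i (-j) := by
  intro i j
  have := h i (-j)
  simp only
  rw [show -(j + 1) = -j - 1 by ring, show -(j - 1) = -j + 1 by ring]
  omega

/-- Each diagonal neighbour `(±1, ±1)` of a code point is dominated by one of two knight moves,
while `(±2, 0)` and `(0, ±2)` each forbid a pair of mirror images. One choice therefore determines
the other three. -/
theorem IsGridCode.isChiralAt (h : IsGridCode F) {i j : ℤ} (hij : F i j = 1) :
    IsChiralAt F 1 i j ∨ IsChiralAt F (-1) i j := by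
  have key : ∀ G : ℤ → ℤ → ℕ, IsGridCode G → G 0 0 = 1 →
      IsChiralAt G 1 0 0 ∨ IsChiralAt G (-1) 0 0 := by
    intro G h h0
    have a0 := h 0 0
    have a1 := h 1 0
    have a2 := h (-1) 0
    have a3 := h 0 1
    have a4 := h 0 (-1)
    have b1 := h 1 1
    have b2 := h 1 (-1)
    have b3 := h (-1) 1
    have b4 := h (-1) (-1)
    have c1 := h 2 0
    have c2 := h (-2) 0
    have c3 := h 0 2
    have c4 := h 0 (-2)
    norm_num [IsChiralAt] at *
    have z1 : G 1 1 = 0 := by clear * - h0 a1; omega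
    have z2 : G 1 (-1) = 0 := by clear * - h0 a1; omega
    have z3 : G (-1) 1 = 0 := by clear * - h0 a2; omega
    have z4 : G (-1) (-1) = 0 := by clear * - h0 a2; omega
    have y1 : G 1 0 = 0 := by clear * - h0 a0; omega
    have y2 : G (-1) 0 = 0 := by clear * - h0 a0; omega
    have y3 : G 0 1 = 0 := by clear * - h0 a0; omega
    have y4 : G 0 (-1) = 0 := by clear * - h0 a0; omega
    have x1 : G 2 0 = 0 := by clear * - h0 a1; omega
    have x2 : G (-2) 0 = 0 := by clear * - h0 a2; omega
    have x3 : G 0 2 = 0 := by clear * - h0 a3; omega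
    have x4 : G 0 (-2) = 0 := by clear * - h0 a4; omega
    clear a0 a1 a2 a3 a4 h
    simp only [z1, z2, z3, z4, y1, y2, y3, y4, x1, x2, x3, x4, h0, true_and] at *
    omega
  have := key (fun p q => F (i + p) (j + q)) (fun p q => by
    have := h (i + p) (j + q)
    simpa only [add_assoc, add_sub_assoc] using this) (by simpa using hij)
  simpa [IsChiralAt, sub_eq_add_neg] using this

/-- The opposite chirality at a knight neighbour would produce two adjacent code points. -/
theorem IsGridCode.isChiralAt_of_knight (h : IsGridCode F) {i j p q : ℤ}
    (hij : IsChiralAt F 1 i j) (hpq : (p = 2 ∧ q = 1) ∨ (p = -2 ∧ q = -1) ∨ (p = 1 ∧ q = -2) ∨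
      (p = -1 ∧ q = 2)) : IsChiralAt F 1 (i + p) (j + q) := by
  have hF : F (i + p) (j + q) = 1 := by
    obtain ⟨-, h₁, h₂, h₃, h₄⟩ := hij
    rcases hpq with ⟨rfl, rfl⟩ | ⟨rfl, rfl⟩ | ⟨rfl, rfl⟩ | ⟨rfl, rfl⟩ <;> assumption
  refine (h.isChiralAt hF).resolve_right ?_
  rintro ⟨-, k₁, k₂, k₃, k₄⟩
  obtain ⟨-, h₁, h₂, h₃, h₄⟩ := hij
  rcases hpq with ⟨rfl, rfl⟩ | ⟨rfl, rfl⟩ | ⟨rfl, rfl⟩ | ⟨rfl, rfl⟩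
  · have := h (i - 1) (j + 2)
    rw [show i - 1 + 1 = i + 2 - 2 by ring, show j + 2 = j + 1 - -1 by ring, k₂,
      show j + 1 - -1 = j + 2 by ring, h₄] at this
    omega
  · have := h (i + 1) (j - 2)
    rw [show i + 1 - 1 = i + -2 + 2 by ring, show j - 2 = j + -1 + -1 by ring, k₁,
      show j + -1 + -1 = j - 2 by ring, h₃] at this
    omega
  · have := h (i + 2) (j + 1)
    rw [show j + 1 - 1 = j + -2 + 2 by ring, show i + 2 = i + 1 - -1 by ring, k₄,
      show i + 1 - -1 = i + 2 by ring, h₁] at this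
    omega
  · have := h (i - 2) (j - 1)
    rw [show j - 1 + 1 = j + 2 - 2 by ring, show i - 2 = i + -1 + -1 by ring, k₃,
      show i + -1 + -1 = i - 2 by ring, h₂] at this
    omega

theorem IsGridCode.five_dvd_of_isChiralAt (h : IsGridCode F) (h0 : IsChiralAt F 1 0 0) {i j : ℤ}
    (hij : F i j = 1) : 5 ∣ i - 2 * j := by
  have row : ∀ k : ℤ, IsChiralAt F 1 (5 * k) 0 := by
    intro k
    induction k with
    | zero => simpa using h0
    | succ k ih =>
      -- `(5, 0) = 2 (2, 1) + (1, -2)`.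
      have h₁ := h.isChiralAt_of_knight (h.isChiralAt_of_knight (h.isChiralAt_of_knight ih
        (p := 2) (q := 1) (by simp)) (p := 2) (q := 1) (by simp)) (p := 1) (q := -2) (by simp)
      convert h₁ using 1 <;> ring
    | pred k ih =>
      have h₁ := h.isChiralAt_of_knight (h.isChiralAt_of_knight (h.isChiralAt_of_knight ih
        (p := -2) (q := -1) (by simp)) (p := -2) (q := -1) (by simp)) (p := -1) (q := 2) (by simp)
      convert h₁ using 1 <;> ring
  have lattice : ∀ k l : ℤ, IsChiralAt F 1 (5 * k + 2 * l) l := by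
    intro k l
    induction l with
    | zero => simpa using row k
    | succ l ih =>
      have h₁ := h.isChiralAt_of_knight ih (p := 2) (q := 1) (by simp)
      convert h₁ using 1
      ring
    | pred l ih =>
      have h₁ := h.isChiralAt_of_knight ih (p := -2) (q := -1) (by simp)
      convert h₁ using 1 <;> ring
  have value : ∀ p q : ℤ, 5 ∣ p - 2 * q → F p q = 1 := by
    rintro p q ⟨k, hk⟩
    have := (lattice k q).1
    rwa [show 5 * k + 2 * q = p by omega] at this
  have hsum := h i j
  -- On a closed neighbourhood `i - 2j` takes every residue modulo five, so a point off the lattice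
  -- is adjacent to a code point.
  rcases (by omega : 5 ∣ i - 2 * j ∨ 5 ∣ i + 1 - 2 * j ∨ 5 ∣ i - 1 - 2 * j ∨
    5 ∣ i - 2 * (j + 1) ∨ 5 ∣ i - 2 * (j - 1)) with hd | hd | hd | hd | hd
  · exact hd
  all_goals
    have := value _ _ hd
    omega

/-- A perfect code of the square grid that contains the origin is contained in one of the two
lattices of index five that contain a knight move. -/
theorem IsGridCode.five_dvd (h : IsGridCode F) (h0 : F 0 0 = 1) :
    (∀ i j, F i j = 1 → 5 ∣ i - 2 * j) ∨ (∀ i j, F i j = 1 → 5 ∣ i + 2 * j) := by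
  rcases h.isChiralAt h0 with hc | hc
  · exact Or.inl fun i j hij => h.five_dvd_of_isChiralAt hc hij
  · refine Or.inr fun i j hij => ?_
    have h₁ : IsChiralAt (fun i j => F i (-j)) 1 0 0 := by
      simpa [IsChiralAt, and_assoc, and_comm, and_left_comm] using hc
    have := h.reflect.five_dvd_of_isChiralAt h₁ (i := i) (j := -j) (by simpa using hij)
    omega

end GridCode

/-! ### Lines of the grid generated by two involutions -/

section Alternating

variable {G : Type*} [Group G]

/-- The alternating products `…, y, 1, x, y * x, x * y * x, …` of two elements. -/
def alternatingProd (x y : G) (i : ℤ) : G :=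
  if Even i then (y * x) ^ (i / 2) else x * (y * x) ^ (i / 2)

theorem alternatingProd_two_mul (x y : G) (k : ℤ) : alternatingProd x y (2 * k) = (y * x) ^ k := by
  simp [alternatingProd]

theorem alternatingProd_two_mul_add_one (x y : G) (k : ℤ) :
    alternatingProd x y (2 * k + 1) = x * (y * x) ^ k := by
  have : (2 * k + 1) / 2 = k := by omega
  simp [alternatingProd, this]

/-- Left multiplication by the two involutions moves along the sequence of alternating products. -/
theorem add_apply_alternatingProd {x y : G} (hx : x * x = 1) (hy : y * y = 1) (χ : G → ℕ) (u : G)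
    (i : ℤ) :
    χ (x * (alternatingProd x y i * u)) + χ (y * (alternatingProd x y i * u)) =
      χ (alternatingProd x y (i + 1) * u) + χ (alternatingProd x y (i - 1) * u) := by
  obtain ⟨k, rfl | rfl⟩ := Int.even_or_odd' i
  · rw [alternatingProd_two_mul_add_one, show 2 * k - 1 = 2 * (k - 1) + 1 by ring,
      alternatingProd_two_mul_add_one, alternatingProd_two_mul]
    have : y * ((y * x) ^ k * u) = x * (y * x) ^ (k - 1) * u := by
      rw [show k = 1 + (k - 1) by ring, zpow_one_add]
      simp only [← mul_assoc, hy, one_mul, add_sub_cancel_left]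
    rw [this, mul_assoc x ((y * x) ^ k) u]
  · rw [show 2 * k + 1 + 1 = 2 * (k + 1) by ring, show 2 * k + 1 - 1 = 2 * k by ring,
      alternatingProd_two_mul_add_one, alternatingProd_two_mul, alternatingProd_two_mul,
      add_comm k 1, zpow_one_add]
    simp only [← mul_assoc, hx, one_mul]
    exact add_comm _ _

end Alternating

/-! ### Constraints imposed by a code in a generalized dihedral group -/

section GeneralizedDihedral

variable {G : Type*} [Group G] {A : Subgroup G} {t : G}

theorem IsGeneralizedDihedral.mul_self (hG : IsGeneralizedDihedral A t) : t * t = 1 := by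
  rw [← sq, ← hG.orderOf_eq, pow_orderOf_eq_one]

theorem IsGeneralizedDihedral.mul_mul_cancel (hG : IsGeneralizedDihedral A t) (g : G) :
    t * (t * g) = g := by
  rw [← mul_assoc, hG.mul_self, one_mul]

theorem IsGeneralizedDihedral.mul_mem (hG : IsGeneralizedDihedral A t) {g : G} (hg : g ∉ A) :
    t * g ∈ A := by
  rw [Subgroup.mul_mem_iff_of_index_two hG.index_eq]
  simp [hg, hG.not_mem]

theorem IsGeneralizedDihedral.mul_notMem (hG : IsGeneralizedDihedral A t) {g : G} (hg : g ∈ A) :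
    t * g ∉ A := by
  rw [Subgroup.mul_mem_iff_of_index_two hG.index_eq]
  simp [hg, hG.not_mem]

theorem IsGeneralizedDihedral.mul_comm_inv (hG : IsGeneralizedDihedral A t) {a : G} (ha : a ∈ A) :
    a * t = t * a⁻¹ := by
  rw [← hG.conj a ha, mul_assoc, hG.mul_mul_cancel]

theorem IsGeneralizedDihedral.exists_eq_mul (hG : IsGeneralizedDihedral A t) {g : G}
    (hg : g ∉ A) : ∃ a ∈ A, g = t * a :=
  ⟨t * g, hG.mul_mem hg, (hG.mul_mul_cancel g).symm⟩

theorem IsGeneralizedDihedral.mul_comm_of_notMem (hG : IsGeneralizedDihedral A t) {a g : G}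
    (ha : a ∈ A) (hg : g ∉ A) : a * g = g * a⁻¹ := by
  obtain ⟨b, hb, rfl⟩ := hG.exists_eq_mul hg
  rw [← mul_assoc, hG.mul_comm_inv ha, mul_assoc, mul_assoc, hG.comm _ (A.inv_mem ha) _ hb]

theorem IsGeneralizedDihedral.mul_self_of_notMem (hG : IsGeneralizedDihedral A t) {g : G}
    (hg : g ∉ A) : g * g = 1 := by
  obtain ⟨a, ha, rfl⟩ := hG.exists_eq_mul hg
  rw [mul_assoc, hG.mul_comm_of_notMem ha (hG.mul_notMem ha), ← mul_assoc, hG.mul_mul_cancel,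
    mul_inv_cancel]

/-- An involution of `A` is central. -/
theorem IsGeneralizedDihedral.commute_of_inv_eq (hG : IsGeneralizedDihedral A t) {z : G}
    (hz : z ∈ A) (hz' : z⁻¹ = z) (g : G) : Commute z g := by
  by_cases hg : g ∈ A
  · exact hG.comm z hz g hg
  · have := hG.mul_comm_of_notMem hz hg
    rwa [hz'] at this

/-- The product `a * b` lies in `A` and is inverted by `c`. This closes the hexagons in the Cayley
graph. -/
theorem IsGeneralizedDihedral.mul_mul_reverse (hG : IsGeneralizedDihedral A t) {a b c : G}
    (ha : a ∉ A) (hb : b ∉ A) (hc : c ∉ A) : a * (b * c) = c * (b * a) := by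
  have hab : a * b ∈ A := by
    rw [Subgroup.mul_mem_iff_of_index_two hG.index_eq]
    simp [ha, hb]
  have hinv : (a * b)⁻¹ = b * a := by
    rw [mul_inv_rev, inv_eq_of_mul_eq_one_left (hG.mul_self_of_notMem ha),
      inv_eq_of_mul_eq_one_left (hG.mul_self_of_notMem hb)]
  rw [← mul_assoc, hG.mul_comm_of_notMem hab hc, hinv]

/-- Moving `g` past `s` either fixes or inverts `s`, so the pair `{s, s⁻¹}` is preserved. This
yields the second coordinate of the grid. -/
theorem IsGeneralizedDihedral.add_apply_mul (hG : IsGeneralizedDihedral A t) {s : G} (hs : s ∈ A)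
    (χ : G → ℕ) (g u : G) :
    χ (s * (g * u)) + χ (s⁻¹ * (g * u)) = χ (g * (s * u)) + χ (g * (s⁻¹ * u)) := by
  by_cases hg : g ∈ A
  · simp only [← mul_assoc]
    rw [hG.comm s hs g hg, hG.comm _ (A.inv_mem hs) g hg]
  · simp only [← mul_assoc]
    rw [hG.mul_comm_of_notMem hs hg, hG.mul_comm_of_notMem (A.inv_mem hs) hg, inv_inv]
    exact add_comm _ _

/-- A perfect code, translated so as to contain the identity, has an indicator function that sums
to one over each closed neighbourhood. -/
theorem exists_indicator_of_isPerfectCode {S : Set G} {hone : (1 : G) ∉ S}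
    {hinv : ∀ s ∈ S, s⁻¹ ∈ S} {D : Set G} (hD : IsPerfectCode (cayleyGraph S hone hinv) D)
    {a b c d : G} (hS : S = {a, b, c, d}) (hab : a ≠ b) (hac : a ≠ c) (had : a ≠ d) (hbc : b ≠ c)
    (hbd : b ≠ d) (hcd : c ≠ d) :
    ∃ χ : G → ℕ, χ 1 = 1 ∧
      ∀ g, χ g + χ (a * g) + χ (b * g) + χ (c * g) + χ (d * g) = 1 := by
  classical
  obtain ⟨v, ⟨hv, -⟩, -⟩ := hD 1
  have h1 : 1 ≠ a ∧ 1 ≠ b ∧ 1 ≠ c ∧ 1 ≠ d := by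
    refine ⟨?_, ?_, ?_, ?_⟩ <;> rintro rfl <;> exact hone (by simp [hS])
  obtain ⟨h1a, h1b, h1c, h1d⟩ := h1
  refine ⟨fun g => if g * v ∈ D then 1 else 0, by simp [hv], fun g => ?_⟩
  obtain ⟨u, ⟨hu, huv⟩, huniq⟩ := hD (g * v)
  have hs : ∃ s ∈ insert 1 S, s * (g * v) = u := by
    rcases huv with rfl | huv
    · exact ⟨1, by simp, one_mul _⟩
    · exact ⟨_, Or.inr (hinv _ huv), by group⟩
  obtain ⟨s, hs, rfl⟩ := hs
  have key : ∀ s' ∈ insert 1 S, (s' * (g * v) ∈ D ↔ s' = s) := by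
    intro s' hs'
    refine ⟨fun h => ?_, fun h => h ▸ hu⟩
    refine mul_right_cancel (huniq _ ⟨h, ?_⟩)
    rcases hs' with rfl | hs'
    · exact Or.inl (one_mul _)
    · refine Or.inr ?_
      have := hinv _ hs'
      change g * v * (s' * (g * v))⁻¹ ∈ S
      rwa [mul_inv_rev, mul_inv_cancel_left]
  subst hS
  have k1 := key 1 (by simp)
  have ka := key a (by simp)
  have kb := key b (by simp)
  have kc := key c (by simp)
  have kd := key d (by simp)
  rw [one_mul] at k1
  simp only [mul_assoc, k1, ka, kb, kc, kd]
  rcases hs with rfl | rfl | rfl | rfl | rfl <;>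
    simp [h1a, h1b, h1c, h1d, hab, hac, had, hbc, hbd, hcd, h1a.symm, h1b.symm, h1c.symm, h1d.symm,
      hab.symm, hac.symm, had.symm, hbc.symm, hbd.symm, hcd.symm]

/-- A map from the square grid to a Cayley graph that is bijective on closed neighbourhoods pulls
perfect codes back. -/
theorem isGridCode_of_indicator {χ : G → ℕ} {x y z w : G} {u v : ℤ → G}
    (h : ∀ g, χ g + χ (x * g) + χ (y * g) + χ (z * g) + χ (w * g) = 1)
    (hu : ∀ i g, χ (x * (u i * g)) + χ (y * (u i * g)) = χ (u (i + 1) * g) + χ (u (i - 1) * g))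
    (hv : ∀ i j, χ (z * (u i * v j)) + χ (w * (u i * v j)) =
      χ (u i * v (j + 1)) + χ (u i * v (j - 1))) :
    IsGridCode fun i j => χ (u i * v j) := by
  intro i j
  have h₁ := h (u i * v j)
  have h₂ := hu i (v j)
  have h₃ := hv i j
  simp only
  omega

/-- Two involutions together with two central involutions have no perfect code. -/
theorem not_indicator_of_central_involutions {χ : G → ℕ} {x y z w : G} (h1 : χ 1 = 1)
    (h : ∀ g, χ g + χ (x * g) + χ (y * g) + χ (z * g) + χ (w * g) = 1)
    (hx : x * x = 1) (hy : y * y = 1) (hz : z * z = 1) (hw : w * w = 1)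
    (hzc : ∀ g, Commute z g) (hwc : ∀ g, Commute w g) : False := by
  have hg := isGridCode_of_indicator (u := alternatingProd x y) (v := alternatingProd z w) h
    (fun i g => add_apply_alternatingProd hx hy χ g i) (fun i j => by
      have := add_apply_alternatingProd hz hw (fun g => χ (alternatingProd x y i * g)) 1 j
      simp only [mul_one] at this
      rw [← this, (hzc _).left_comm, (hwc _).left_comm])
  -- As `z` and `w` commute, the grid has period `4` in the second direction, which puts `(0, 4)` in
  -- the code.
  have hv : alternatingProd z w 4 = 1 := by
    have := alternatingProd_two_mul z w 2
    norm_num at this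
    rw [this, (hwc z).mul_pow, sq, sq, hz, hw, one_mul]
  have hu : alternatingProd x y 0 = 1 := by simpa using alternatingProd_two_mul x y 0
  have hv₀ : alternatingProd z w 0 = 1 := by simpa using alternatingProd_two_mul z w 0
  rcases hg.five_dvd (by simpa [hu, hv₀] using h1) with hd | hd
  · have := hd 0 4 (by simpa [hu, hv] using h1)
    omega
  · have := hd 0 4 (by simpa [hu, hv] using h1)
    omega

/-- The grid of a perfect code with connection set `{x, y, s, s⁻¹}`, where `x, y` are involutions
and `s ∈ A`. -/
theorem IsGeneralizedDihedral.isGridCode (hG : IsGeneralizedDihedral A t) {χ : G → ℕ} {x y s : G}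
    (h : ∀ g, χ g + χ (x * g) + χ (y * g) + χ (s * g) + χ (s⁻¹ * g) = 1)
    (hx : x * x = 1) (hy : y * y = 1) (hs : s ∈ A) :
    IsGridCode fun i j => χ (alternatingProd x y i * s ^ j) :=
  isGridCode_of_indicator h (fun i g => add_apply_alternatingProd hx hy χ g i) fun i j => by
    rw [hG.add_apply_mul hs, ← zpow_one_add, add_comm 1 j, ← zpow_neg_one, ← zpow_add,
      neg_add_eq_sub]

theorem IsGeneralizedDihedral.not_indicator_of_inverse_pair (hG : IsGeneralizedDihedral A t)
    {χ : G → ℕ} {x z s : G} (h1 : χ 1 = 1)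
    (h : ∀ g, χ g + χ (x * g) + χ (z * g) + χ (s * g) + χ (s⁻¹ * g) = 1)
    (hx : x * x = 1) (hz : z * z = 1) (hzc : ∀ g, Commute z g) (hs : s ∈ A) : False := by
  have hg := hG.isGridCode h hx hz hs
  have hu : alternatingProd x z 4 = 1 := by
    have := alternatingProd_two_mul x z 2
    norm_num at this
    rw [this, (hzc x).mul_pow, sq, sq, hx, hz, one_mul]
  have hu₀ : alternatingProd x z 0 = 1 := by simpa using alternatingProd_two_mul x z 0
  rcases hg.five_dvd (by simpa [hu₀] using h1) with hd | hd
  · have := hd 4 0 (by simpa [hu] using h1)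
    omega
  · have := hd 4 0 (by simpa [hu] using h1)
    omega

/-- A perfect code with connection set `{t, t * s₀, s₁, s₁⁻¹}` restricts the relations between
`s₀` and `s₁` modulo five. -/
theorem IsGeneralizedDihedral.five_dvd_of_inverse_pair (hG : IsGeneralizedDihedral A t)
    {χ : G → ℕ} {s₀ s₁ : G} (hs₀ : s₀ ∈ A) (hs₁ : s₁ ∈ A) (h1 : χ 1 = 1)
    (h : ∀ g, χ g + χ (t * g) + χ (t * s₀ * g) + χ (s₁ * g) + χ (s₁⁻¹ * g) = 1) :
    (∀ i j : ℤ, s₀ ^ i * s₁ ^ j = 1 → 5 ∣ i + j) ∨ (∀ i j : ℤ, s₀ ^ i * s₁ ^ j = 1 → 5 ∣ i - j) := by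
  have hg := hG.isGridCode h hG.mul_self (hG.mul_self_of_notMem (hG.mul_notMem hs₀)) hs₁
  have hu : ∀ k : ℤ, alternatingProd t (t * s₀) (2 * -k) = s₀ ^ k := fun k => by
    rw [alternatingProd_two_mul, hG.conj s₀ hs₀, inv_zpow', neg_neg]
  have hu₀ : alternatingProd t (t * s₀) 0 = 1 := by simpa using hu 0
  rcases hg.five_dvd (by simpa [hu₀] using h1) with hd | hd
  · refine Or.inl fun i j hij => ?_
    have := hd (2 * -i) j (by simpa only [hu, hij] using h1)
    omega
  · refine Or.inr fun i j hij => ?_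
    have := hd (2 * -i) j (by simpa only [hu, hij] using h1)
    omega

/-- Two code points in the two layers over a hexagon of the Cayley graph of three reflections and
a central involution are incompatible. -/
theorem hexagon_contradiction {χ : G → ℕ} {a b c z : G} (h1 : χ 1 = 1)
    (h : ∀ g, χ g + χ (a * g) + χ (b * g) + χ (c * g) + χ (z * g) = 1)
    (ha : a * a = 1) (hb : b * b = 1) (hc : c * c = 1) (hz : z * z = 1)
    (hzc : ∀ g, Commute z g) (habc : a * (c * b) = b * (c * a)) (hca : χ (z * (c * a)) = 1) :
    False := by
  have h' : ∀ g, χ (z * g) + χ (z * (a * g)) + χ (z * (b * g)) + χ (z * (c * g)) + χ g = 1 := by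
    intro g
    have := h (z * g)
    rwa [← (hzc a).left_comm, ← (hzc b).left_comm, ← (hzc c).left_comm, ← mul_assoc z z, hz,
      one_mul] at this
  have e₁ := h 1
  have e₁' := h' 1
  have e₂ := h b
  have e₃' := h' (a * (c * b))
  have e₄ := h (c * b)
  have e₄' := h' (c * b)
  have e₅ := h (b * (c * b))
  have ra : ∀ g, a * (a * g) = g := fun g => by rw [← mul_assoc, ha, one_mul]
  have rb : ∀ g, b * (b * g) = g := fun g => by rw [← mul_assoc, hb, one_mul]
  have rc : ∀ g, c * (c * g) = g := fun g => by rw [← mul_assoc, hc, one_mul]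
  have rab : b * (a * (c * b)) = c * a := by rw [habc, rb]
  simp only [mul_one, hb] at e₁ e₁' e₂
  rw [rab, ra] at e₃'
  rw [rc] at e₄ e₄'
  -- The code points `1` and `z * (c * a)` leave only `b * (c * b)` and its translate by `z` to
  -- dominate `c * b` and `z * (c * b)`. Those two dominators are adjacent.
  have z₁ : χ (c * b) = 0 := by omega
  have z₂ : χ b = 0 := by omega
  have z₃ : χ (z * b) = 0 := by omega
  have z₄ : χ (z * (c * b)) = 0 := by omega
  have z₅ : χ (a * (c * b)) = 0 := by omega
  have z₆ : χ (z * (a * (c * b))) = 0 := by omega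
  have z₇ : χ (b * (c * b)) = 1 := by omega
  have z₈ : χ (z * (b * (c * b))) = 1 := by omega
  omega

/-- Three reflections together with an involution of `A` have no perfect code. -/
theorem IsGeneralizedDihedral.not_indicator_of_three_reflections (hG : IsGeneralizedDihedral A t)
    {χ : G → ℕ} {a b c z : G} (h1 : χ 1 = 1)
    (h : ∀ g, χ g + χ (a * g) + χ (b * g) + χ (c * g) + χ (z * g) = 1)
    (ha : a ∉ A) (hb : b ∉ A) (hc : c ∉ A) (hz : z ∈ A) (hz' : z⁻¹ = z) : False := by
  have hzz : z * z = 1 := by nth_rw 2 [← hz']; exact mul_inv_cancel z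
  have hzc := hG.commute_of_inv_eq hz hz'
  have ha₂ := hG.mul_self_of_notMem ha
  have hb₂ := hG.mul_self_of_notMem hb
  have hc₂ := hG.mul_self_of_notMem hc
  have k₁ : χ (z * (c * a)) ≠ 1 :=
    hexagon_contradiction h1 h ha₂ hb₂ hc₂ hzz hzc (hG.mul_mul_reverse ha hc hb)
  have k₂ : χ (z * (b * a)) ≠ 1 := hexagon_contradiction (a := a) (b := c) (c := b) h1
    (fun g => by have := h g; omega) ha₂ hc₂ hb₂ hzz hzc (hG.mul_mul_reverse ha hb hc)
  -- The vertex `z * a` cannot be dominated: `z * a`, `z` and `a` are too close to `1`, and the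
  -- hexagons exclude `z * (b * a)` and `z * (c * a)`.
  have e₁ := h 1
  have e₂ := h a
  have e₃ := h (z * a)
  have e₄ := h z
  rw [← (hzc b).left_comm, ← (hzc c).left_comm, (hzc a).eq, ← mul_assoc a a, ha₂, one_mul] at e₃
  rw [← (hzc a).eq, hzz] at e₄
  rw [← (hzc a).eq, ← mul_assoc z z, hzz, one_mul] at e₃
  simp only [mul_one] at e₁
  omega

/-- A perfect code for four reflections `t, t * x, t * y, t * z` restricts the relations between
`x, y, z` modulo five, up to their order. -/
theorem IsGeneralizedDihedral.five_dvd_of_four_reflections (hG : IsGeneralizedDihedral A t)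
    {χ : G → ℕ} {x y z : G} (hx : x ∈ A) (hy : y ∈ A) (hz : z ∈ A) (h1 : χ 1 = 1)
    (h : ∀ g, χ g + χ (t * g) + χ (t * x * g) + χ (t * y * g) + χ (t * z * g) = 1) :
    (∀ i j l : ℤ, x ^ i * y ^ j * z ^ l = 1 → 5 ∣ 2 * i + 3 * j + l) ∨
    (∀ i j l : ℤ, x ^ i * z ^ j * y ^ l = 1 → 5 ∣ 2 * i + 3 * j + l) ∨
    (∀ i j l : ℤ, y ^ i * x ^ j * z ^ l = 1 → 5 ∣ 2 * i + 3 * j + l) ∨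
    (∀ i j l : ℤ, y ^ i * z ^ j * x ^ l = 1 → 5 ∣ 2 * i + 3 * j + l) ∨
    (∀ i j l : ℤ, z ^ i * x ^ j * y ^ l = 1 → 5 ∣ 2 * i + 3 * j + l) ∨
    (∀ i j l : ℤ, z ^ i * y ^ j * x ^ l = 1 → 5 ∣ 2 * i + 3 * j + l) := by
  let : CommGroup A := { (inferInstance : Group A) with
    mul_comm := fun a b => Subtype.ext (hG.comm a a.2 b b.2) }
  lift x to A using hx
  lift y to A using hy
  lift z to A using hz
  set f : Additive A → ℕ := fun a => χ (a.toMul : G)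
  set g : Additive A → ℕ := fun a => χ (t * (a.toMul : G))
  -- The vertex `a` of `A` is joined to `t * (c * a)` for `c = 1, x, y, z`; the reflection `t`
  -- itself has label `0`.
  have hcode : IsBipartiteCode f g 0 (.ofMul x) (.ofMul y) (.ofMul z) := by
    constructor
    · intro a
      have := h (a.toMul : G)
      simp only [mul_assoc] at this
      rw [hG.comm x x.2 _ a.toMul.2, hG.comm y y.2 _ a.toMul.2, hG.comm z z.2 _ a.toMul.2] at this
      simpa [f, g] using this
    · intro a
      have := h (t * (a.toMul : G))
      have e : ∀ b : A, t * b * (t * (a.toMul : G)) = a.toMul * (b : G)⁻¹ := fun b => by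
        rw [← mul_assoc, hG.conj b b.2, hG.comm _ (A.inv_mem b.2) _ a.toMul.2]
      rw [e, e, e, hG.mul_mul_cancel] at this
      simpa [f, g, div_eq_mul_inv] using this
  have key : ∀ u v w : A,
      IsBipartiteCode f g 0 (.ofMul u) (.ofMul v) (.ofMul w) →
      IsCyclicAt f g 0 (.ofMul u) (.ofMul v) (.ofMul w) 0 →
      ∀ i j l : ℤ, (u : G) ^ i * (v : G) ^ j * (w : G) ^ l = 1 → 5 ∣ 2 * i + 3 * j + l := by
    intro u v w hb hc i j l hrel
    refine hb.five_dvd_of_relation hc ?_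
    simp only [sub_zero]
    apply Additive.toMul.injective
    apply Subtype.ext
    simpa using hrel
  rcases hcode.exists_isCyclicAt (a := 0) (by simpa [f] using h1) with c | c | c | c | c | c
  · exact Or.inl (key _ _ _ hcode c)
  · exact Or.inr (Or.inl (key _ _ _ hcode.perm₃₄ c))
  · exact Or.inr (Or.inr (Or.inl (key _ _ _ hcode.perm₂₃ c)))
  · exact Or.inr (Or.inr (Or.inr (Or.inl (key _ _ _ hcode.perm₂₃.perm₃₄ c))))
  · exact Or.inr (Or.inr (Or.inr (Or.inr (Or.inl (key _ _ _ hcode.perm₃₄.perm₂₃ c)))))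
  · exact Or.inr (Or.inr (Or.inr (Or.inr (Or.inr
      (key _ _ _ hcode.perm₃₄.perm₂₃.perm₃₄ c)))))

end GeneralizedDihedral

/-! ### From relations to the families, and codes from weights -/

section Families

variable {G : Type*} [Group G] {A : Subgroup G} {t : G}

theorem exists_isMinPowMem [Finite G] (x : G) (H : Subgroup G) : ∃ m, IsMinPowMem x H m := by
  classical
  have h : ∃ k : ℕ, 0 < k ∧ x ^ k ∈ H :=
    ⟨orderOf x, orderOf_pos x, by simp [pow_orderOf_eq_one]⟩
  exact ⟨Nat.find h, Nat.find_spec h, fun k hk => Nat.find_min' h hk⟩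

theorem IsMinPowMem.dvd {x : G} {H : Subgroup G} {m : ℕ} (hm : IsMinPowMem x H m) {k : ℤ}
    (hk : x ^ k ∈ H) : (m : ℤ) ∣ k := by
  obtain ⟨⟨hm₀, hm₁⟩, hmin⟩ := hm
  have hpos : (0 : ℤ) < m := by exact_mod_cast hm₀
  have hr : x ^ (k % m) ∈ H := by
    rw [Int.emod_def, zpow_sub, zpow_mul]
    exact H.mul_mem hk (H.inv_mem (H.zpow_mem (by simpa using hm₁) _))
  have h₁ := Int.emod_nonneg k hpos.ne'
  have h₂ := Int.emod_lt_of_pos k hpos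
  lift k % m to ℕ using h₁ with r hr'
  rw [zpow_natCast] at hr
  rcases Nat.eq_zero_or_pos r with rfl | hr₀
  · exact Int.dvd_of_emod_eq_zero (by simpa using hr'.symm)
  · have := hmin ⟨hr₀, hr⟩
    omega

/-- The multiples of five in the exponent of `x` can be reduced modulo the order of `x`. -/
theorem exists_zpow_five_mul_add {x : G} [Finite G] (h5 : 5 ∣ orderOf x) (q c : ℤ) :
    ∃ α : ℤ, (0 ≤ α ∧ α ≤ (orderOf x : ℤ) / 5 - 1) ∧ x ^ (5 * q + c) = x ^ (5 * α + c) := by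
  obtain ⟨n, hn⟩ := h5
  have hpos := orderOf_pos x
  have hn' : (orderOf x : ℤ) / 5 = n := by omega
  have hn₀ : (0 : ℤ) < n := by omega
  refine ⟨q % n, ⟨Int.emod_nonneg _ hn₀.ne', ?_⟩, ?_⟩
  · have := Int.emod_lt_of_pos q hn₀
    omega
  · rw [zpow_eq_zpow_iff_modEq, hn]
    refine Int.ModEq.add_right _ ?_
    push_cast
    exact (Int.mod_modEq q n).symm.mul_left'

/-- The congruence is applied to `s₀ ^ n = 1`, giving `5 ∣ n`, and to the relation expressing `s₁ ^
m` as a power of `s₀`. -/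
theorem firstFamily_of_relations [Finite G] {S : Set G} {s₀ s₁ : G} (hs₀ : s₀ ∈ A) (hs₁ : s₁ ∈ A)
    (hS : S = {s₁, s₁⁻¹, t, t * s₀})
    (h : (∀ i j : ℤ, s₀ ^ i * s₁ ^ j = 1 → 5 ∣ i + j) ∨
      (∀ i j : ℤ, s₀ ^ i * s₁ ^ j = 1 → 5 ∣ i - j)) : FirstFamily A t S := by
  obtain ⟨m, hm⟩ := exists_isMinPowMem s₁ (Subgroup.zpowers s₀)
  have h5 : 5 ∣ orderOf s₀ := by
    have h₀ : s₀ ^ (orderOf s₀ : ℤ) * s₁ ^ (0 : ℤ) = 1 := by simp [pow_orderOf_eq_one]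
    rcases h with h | h
    · have := h _ _ h₀
      omega
    · have := h _ _ h₀
      omega
  obtain ⟨k, hk⟩ := Subgroup.mem_zpowers_iff.mp hm.1.2
  have hrel : s₀ ^ (-k) * s₁ ^ (m : ℤ) = 1 := by simp [← hk]
  refine ⟨s₀, hs₀, s₁, hs₁, orderOf s₀, m, hS, rfl, hm, h5, ?_⟩
  rcases h with h | h
  · obtain ⟨q, hq⟩ := h _ _ hrel
    obtain ⟨α, ⟨hα₀, hα₁⟩, hα⟩ := exists_zpow_five_mul_add h5 (-q) m
    refine ⟨2 * α, by omega, by omega, even_two_mul α, Or.inl ?_⟩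
    rw [show 5 * (2 * α) / 2 = 5 * α by omega, ← hα, ← hk]
    congr 1
    omega
  · obtain ⟨q, hq⟩ := h _ _ hrel
    obtain ⟨α, ⟨hα₀, hα₁⟩, hα⟩ := exists_zpow_five_mul_add h5 (-q) (-m)
    refine ⟨2 * α, by omega, by omega, even_two_mul α, Or.inr ?_⟩
    rw [show 5 * (2 * α) / 2 - (m : ℤ) = 5 * α + -m by omega, ← hα, ← hk]
    congr 1
    omega

theorem Subgroup.mem_closure_pair_of_commute {x y g : G} (hxy : Commute x y)
    (hg : g ∈ Subgroup.closure {x, y}) : ∃ i j : ℤ, g = x ^ i * y ^ j := by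
  induction hg using Subgroup.closure_induction with
  | mem g hg =>
    rcases hg with rfl | rfl
    · exact ⟨1, 0, by simp⟩
    · exact ⟨0, 1, by simp⟩
  | one => exact ⟨0, 0, by simp⟩
  | mul a b _ _ ha hb =>
    obtain ⟨i, j, rfl⟩ := ha
    obtain ⟨k, l, rfl⟩ := hb
    refine ⟨i + k, j + l, ?_⟩
    rw [zpow_add, zpow_add, (hxy.zpow_zpow k j).symm.mul_mul_mul_comm]
  | inv a _ ha =>
    obtain ⟨i, j, rfl⟩ := ha
    exact ⟨-i, -j, by rw [mul_inv_rev, zpow_neg, zpow_neg, (hxy.zpow_zpow i j).inv_inv.eq]⟩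

theorem secondFamily_of_relations [Finite G] (hG : IsGeneralizedDihedral A t) {S : Set G}
    {s₀ s₁ s₂ : G} (hs₀ : s₀ ∈ A) (hs₁ : s₁ ∈ A) (hs₂ : s₂ ∈ A)
    (hS : S = {t, t * s₀, t * s₁, t * s₂})
    (h : ∀ i j l : ℤ, s₁ ^ i * s₂ ^ j * s₀ ^ l = 1 → 5 ∣ 2 * i + 3 * j + l) :
    SecondFamily A t S := by
  obtain ⟨m, hm⟩ := exists_isMinPowMem s₁ (Subgroup.zpowers s₀)
  obtain ⟨l, hl⟩ := exists_isMinPowMem s₂ (Subgroup.closure {s₀, s₁})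
  have h5 : 5 ∣ orderOf s₀ := by
    have := h 0 0 (orderOf s₀) (by simp [pow_orderOf_eq_one])
    omega
  have c₀₁ : Commute s₀ s₁ := hG.comm _ hs₀ _ hs₁
  obtain ⟨k, hk⟩ := Subgroup.mem_zpowers_iff.mp hm.1.2
  obtain ⟨q₁, hq₁⟩ := h m 0 (-k) (by simp [← hk])
  obtain ⟨α₁, hα₁, e₁⟩ := exists_zpow_five_mul_add h5 (m - q₁) (-3 * m)
  obtain ⟨p, r, hpr⟩ := Subgroup.mem_closure_pair_of_commute c₀₁ hl.1.2
  have hm₀ : (0 : ℤ) < m := by exact_mod_cast hm.1.1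
  -- The exponent of `s₁` is reduced modulo `m` at the cost of a power of `s₀`.
  have hpr' : s₂ ^ l = s₀ ^ (p + k * (r / m)) * s₁ ^ (r % m) := by
    rw [hpr, zpow_add, zpow_mul, hk, mul_assoc, ← zpow_natCast, ← zpow_mul, ← zpow_add,
      Int.mul_ediv_add_emod]
  obtain ⟨q₂, hq₂⟩ := h (r % m) (-l) (p + k * (r / m)) (by
    rw [zpow_neg, zpow_natCast, hpr', mul_inv_rev, mul_inv_cancel_left, inv_mul_cancel])
  obtain ⟨α₂, hα₂, e₂⟩ := exists_zpow_five_mul_add h5 (q₂ + l - r % m) (-2 * l + 3 * (r % m))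
  -- The weights of `s₀, s₁, s₂` are `1, 2, 3`, that is `1, -3, -2` modulo five. This is the case `v
  -- = 4`, `a = 3`, `b = 2`; thanks to the freedom of ordering no other `v` is needed.
  refine ⟨s₀, hs₀, s₁, hs₁, s₂, hs₂, orderOf s₀, m, l, hS, rfl, hm, hl, h5, 4, by simp, 3, 2, ?_,
    α₁, α₂, r % m, hα₁, hα₂, ⟨Int.emod_nonneg _ hm₀.ne', ?_⟩, ?_, ?_⟩
  · have : parity 4 = 0 := by decide
    rw [this]
    exact Set.pair_comm _ _
  · have := Int.emod_lt_of_pos r hm₀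
    omega
  · rw [show 5 * α₁ - 3 * (m : ℤ) = 5 * α₁ + -3 * m by ring, ← e₁, ← hk]
    congr 1
    omega
  · rw [show 5 * α₂ - 2 * (l : ℤ) + 3 * (r % m) = 5 * α₂ + (-2 * l + 3 * (r % m)) by ring, ← e₂,
      hpr']
    congr 2
    omega

/-- A family of five translations whose weights modulo five are distinct at each vertex yields
a perfect code. -/
theorem isPerfectCode_of_weight {S : Set G} {hone : (1 : G) ∉ S} {hinv : ∀ s ∈ S, s⁻¹ ∈ S}
    {s : Fin 5 → G} (h0 : s 0 = 1) (hs : Set.range s = insert 1 S)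
    {w : G → ZMod 5} (hw : ∀ v, Function.Injective fun i => w (s i * v)) :
    IsPerfectCode (cayleyGraph S hone hinv) {g | w g = 0} := by
  intro v
  have hb := (Fintype.bijective_iff_injective_and_card _).mpr ⟨hw v, by simp [ZMod.card]⟩
  obtain ⟨i, hi, hiu⟩ := hb.existsUnique 0
  have hadj : ∀ u, (u = v ∨ (cayleyGraph S hone hinv).Adj u v) ↔ ∃ j, u = s j * v := by
    intro u
    constructor
    · rintro (rfl | huv)
      · exact ⟨0, by simp [h0]⟩
      · have h₁ : u * v⁻¹ ∈ Set.range s := by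
          rw [hs]
          refine Or.inr ?_
          have := hinv _ huv
          rwa [mul_inv_rev, inv_inv] at this
        obtain ⟨j, hj⟩ := h₁
        exact ⟨j, by rw [hj, inv_mul_cancel_right]⟩
    · rintro ⟨j, rfl⟩
      have h₁ : s j ∈ insert 1 S := hs ▸ Set.mem_range_self j
      rcases h₁ with h₁ | h₁
      · exact Or.inl (by rw [h₁, one_mul])
      · refine Or.inr ?_
        change v * (s j * v)⁻¹ ∈ S
        rw [mul_inv_rev, mul_inv_cancel_left]
        exact hinv _ h₁
  refine ⟨s i * v, ⟨hi, (hadj _).mpr ⟨i, rfl⟩⟩, ?_⟩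
  rintro u ⟨hu, huv⟩
  obtain ⟨j, rfl⟩ := (hadj u).mp huv
  rw [hiu j hu]

/-- If the Cayley graph is connected, a subgroup of `A` that contains the connection set up to
multiplication by `t` is all of `A`. -/
theorem IsGeneralizedDihedral.le_of_connected (hG : IsGeneralizedDihedral A t) {S : Set G}
    {hone : (1 : G) ∉ S} {hinv : ∀ s ∈ S, s⁻¹ ∈ S} (hconn : (cayleyGraph S hone hinv).Connected)
    {H : Subgroup G} (hH : H ≤ A) (hS : ∀ s ∈ S, s ∈ H ∨ t * s ∈ H) : A ≤ H := by
  -- Since `t` inverts `H`, the union of `H` and `tH` is stable under multiplication, so walks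
  -- starting at `1` stay in it.
  have key : ∀ g, g ∈ H ∨ t * g ∈ H := by
    intro g
    have hr := (SimpleGraph.reachable_iff_reflTransGen _ _).mp (hconn.preconnected 1 g)
    induction hr with
    | refl => exact Or.inl H.one_mem
    | @tail b c _ hbc ih =>
      have hconj : ∀ a ∈ H, t * a * t ∈ H := fun a ha => by
        rw [hG.conj a (hH ha)]
        exact H.inv_mem ha
      have hc : c = c * b⁻¹ * b := by group
      rcases hS _ hbc with hs | hs <;> rcases ih with hb | hb
      · left
        rw [hc]
        exact H.mul_mem hs hb
      · right
        have := H.mul_mem (hconj _ hs) hb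
        rwa [show t * (c * b⁻¹) * t * (t * b) = t * c by
          rw [mul_assoc, hG.mul_mul_cancel]; group] at this
      · right
        have := H.mul_mem hs hb
        rwa [show t * (c * b⁻¹) * b = t * c by group] at this
      · left
        have := H.mul_mem (hconj _ hs) hb
        rwa [hG.mul_mul_cancel, mul_assoc, hG.mul_mul_cancel, inv_mul_cancel_right] at this
  intro a ha
  exact (key a).resolve_right fun h => hG.mul_notMem ha (hH h)

/-- The group generated by the three elements is the quotient of `ℤ³` by its relations. The linear
form with coefficients `1, a, b` kills them modulo five, hence descends. -/
theorem IsGeneralizedDihedral.exists_weight (hG : IsGeneralizedDihedral A t) {s₀ s₁ s₂ : G}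
    (hs₀ : s₀ ∈ A) (hs₁ : s₁ ∈ A) (hs₂ : s₂ ∈ A) (hgen : A ≤ Subgroup.closure {s₀, s₁, s₂})
    {a b : ℤ} (hrel : ∀ i j k : ℤ, s₀ ^ i * s₁ ^ j * s₂ ^ k = 1 → 5 ∣ i + a * j + b * k) :
    ∃ w : G → ZMod 5, (∀ x ∈ A, ∀ y ∈ A, w (x * y) = w x + w y) ∧ w s₀ = 1 ∧ w s₁ = a ∧
      w s₂ = b := by
  have c₀₁ : Commute s₀ s₁ := hG.comm _ hs₀ _ hs₁
  have c₀₂ : Commute s₀ s₂ := hG.comm _ hs₀ _ hs₂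
  have c₁₂ : Commute s₁ s₂ := hG.comm _ hs₁ _ hs₂
  let e : ℤ × ℤ × ℤ → G := fun v => s₀ ^ v.1 * s₁ ^ v.2.1 * s₂ ^ v.2.2
  have hadd : ∀ u v, e (u + v) = e u * e v := by
    intro u v
    simp only [e, Prod.fst_add, Prod.snd_add, zpow_add]
    rw [(((c₀₂.zpow_zpow v.1 u.2.2).mul_left (c₁₂.zpow_zpow v.2.1 u.2.2)).symm).mul_mul_mul_comm,
      (c₀₁.zpow_zpow v.1 u.2.1).symm.mul_mul_mul_comm]
  have hneg : ∀ v, e (-v) = (e v)⁻¹ := fun v => by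
    rw [eq_inv_iff_mul_eq_one, ← hadd, neg_add_cancel]
    simp [e]
  let c : ℤ × ℤ × ℤ → ZMod 5 := fun v => ((v.1 + a * v.2.1 + b * v.2.2 : ℤ) : ZMod 5)
  have hc : ∀ u v, c (u + v) = c u + c v := fun u v => by
    simp only [c, Prod.fst_add, Prod.snd_add, ← Int.cast_add]
    congr 1
    ring
  have hfac : c.FactorsThrough e := by
    intro u v huv
    have h1 : e (u - v) = 1 := by rw [sub_eq_add_neg, hadd, hneg, huv, mul_inv_cancel]
    have h2 : c (u - v) = 0 := (ZMod.intCast_zmod_eq_zero_iff_dvd _ 5).mpr (hrel _ _ _ h1)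
    have h3 := hc (u - v) v
    rwa [sub_add_cancel, h2, zero_add] at h3
  have hsurj : ∀ x ∈ Subgroup.closure {s₀, s₁, s₂}, ∃ v, e v = x := by
    intro x hx
    induction hx using Subgroup.closure_induction with
    | mem g hg =>
      rcases hg with rfl | rfl | rfl
      · exact ⟨(1, 0, 0), by simp [e]⟩
      · exact ⟨(0, 1, 0), by simp [e]⟩
      · exact ⟨(0, 0, 1), by simp [e]⟩
    | one => exact ⟨0, by simp [e]⟩
    | mul g h _ _ hg hh =>
      obtain ⟨u, rfl⟩ := hg
      obtain ⟨v, rfl⟩ := hh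
      exact ⟨u + v, hadd u v⟩
    | inv g _ hg =>
      obtain ⟨u, rfl⟩ := hg
      exact ⟨-u, hneg u⟩
  refine ⟨Function.extend e c 0, ?_, ?_, ?_, ?_⟩
  · intro x hx y hy
    obtain ⟨u, rfl⟩ := hsurj x (hgen hx)
    obtain ⟨v, rfl⟩ := hsurj y (hgen hy)
    rw [← hadd, hfac.extend_apply, hfac.extend_apply, hfac.extend_apply, hc]
  · have := hfac.extend_apply 0 (1, 0, 0)
    simpa [e, c] using this
  · have := hfac.extend_apply 0 (0, 1, 0)
    simpa [e, c] using this
  · have := hfac.extend_apply 0 (0, 0, 1)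
    simpa [e, c] using this

end Families

/-! ### Perfect codes for both families -/

section Converse

variable {G : Type*} [Group G] {A : Subgroup G} {t : G}

/-- By minimality of `m`, every relation is a consequence of `s₀ ^ n = 1` and `s₁ ^ m = s₀ ^ c`, and
both are compatible with the weights `1` and `e`. -/
theorem five_dvd_of_pow_eq {s₀ s₁ : G} {m : ℕ} (hm : IsMinPowMem s₁ (Subgroup.zpowers s₀) m)
    (h5 : 5 ∣ orderOf s₀) {c e : ℤ} (hc : s₁ ^ m = s₀ ^ c) (hce : 5 ∣ c - e * m) {i j : ℤ}
    (h : s₀ ^ i * s₁ ^ j = 1) : 5 ∣ i + e * j := by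
  have hj : s₁ ^ j ∈ Subgroup.zpowers s₀ :=
    Subgroup.mem_zpowers_iff.mpr ⟨-i, by rw [zpow_neg]; exact inv_eq_of_mul_eq_one_right h⟩
  obtain ⟨k, rfl⟩ := hm.dvd hj
  rw [zpow_mul, zpow_natCast, hc, ← zpow_mul, ← zpow_add, ← orderOf_dvd_iff_zpow_eq_one] at h
  have h₁ : (5 : ℤ) ∣ i + c * k := (Int.natCast_dvd_natCast.mpr h5).trans h
  have h₂ := h₁.sub (hce.mul_right k)
  rwa [show i + c * k - (c - e * m) * k = i + e * (m * k) by ring] at h₂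

theorem five_dvd_of_pow_eq_mul {s₀ s₁ s₂ : G} (h₀₁ : Commute s₀ s₁) {m l : ℕ}
    (hm : IsMinPowMem s₁ (Subgroup.zpowers s₀) m)
    (hl : IsMinPowMem s₂ (Subgroup.closure {s₀, s₁}) l) (h5 : 5 ∣ orderOf s₀) {c d r e e' : ℤ}
    (hc : s₁ ^ m = s₀ ^ c) (hce : 5 ∣ c - e * m) (hd : s₂ ^ l = s₀ ^ d * s₁ ^ r)
    (hde : 5 ∣ d + e * r - e' * l) {i j k : ℤ} (h : s₀ ^ i * s₁ ^ j * s₂ ^ k = 1) :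
    5 ∣ i + e * j + e' * k := by
  have hk : s₂ ^ k ∈ Subgroup.closure {s₀, s₁} := by
    rw [← inv_eq_of_mul_eq_one_right h]
    exact inv_mem (mul_mem (zpow_mem (Subgroup.subset_closure (by simp)) _)
      (zpow_mem (Subgroup.subset_closure (by simp)) _))
  obtain ⟨q, rfl⟩ := hl.dvd hk
  rw [zpow_mul, zpow_natCast, hd, (h₀₁.zpow_zpow d r).mul_zpow, ← zpow_mul, ← zpow_mul,
    (h₀₁.zpow_zpow (d * q) j).symm.mul_mul_mul_comm, ← zpow_add, ← zpow_add] at h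
  have h₁ := (five_dvd_of_pow_eq hm h5 hc hce h).sub (hde.mul_right q)
  rwa [show i + d * q + e * (j + r * q) - (d + e * r - e' * l) * q = i + e * j + e' * (l * q) by
    ring] at h₁

theorem map_inv_of_map_mul_on {w : G → ZMod 5}
    (hw : ∀ x ∈ A, ∀ y ∈ A, w (x * y) = w x + w y) {x : G} (hx : x ∈ A) : w x⁻¹ = -w x := by
  have h1 : w 1 = 0 := by simpa using hw 1 A.one_mem 1 A.one_mem
  have h2 := hw _ (A.inv_mem hx) _ hx
  rw [inv_mul_cancel, h1] at h2
  exact eq_neg_of_add_eq_zero_left h2.symm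

open Classical in
/-- The weight on `A` extended to the coset `t A` with the offset `k`. -/
noncomputable def extendWeight (A : Subgroup G) (t : G) (w : G → ZMod 5) (k : ZMod 5) (g : G) :
    ZMod 5 :=
  if g ∈ A then w g else w (t * g) - k

theorem extendWeight_mem {w : G → ZMod 5} {k : ZMod 5} {a : G} (ha : a ∈ A) :
    extendWeight A t w k a = w a := by
  rw [extendWeight, if_pos ha]

theorem IsGeneralizedDihedral.extendWeight_mul (hG : IsGeneralizedDihedral A t) {w : G → ZMod 5}
    {k : ZMod 5} {a : G} (ha : a ∈ A) : extendWeight A t w k (t * a) = w a - k := by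
  rw [extendWeight, if_neg (hG.mul_notMem ha), hG.mul_mul_cancel]

/-- Connection sets of the first family: multiplication by the connection set changes the weights
by distinct amounts. -/
theorem IsGeneralizedDihedral.exists_isPerfectCode_of_inverse_pair
    (hG : IsGeneralizedDihedral A t) {S : Set G} {hone : (1 : G) ∉ S} {hinv : ∀ s ∈ S, s⁻¹ ∈ S}
    {s₀ s₁ : G} (hs₀ : s₀ ∈ A) (hs₁ : s₁ ∈ A) (hS : S = {s₁, s₁⁻¹, t, t * s₀}) {w : G → ZMod 5}
    (hw : ∀ x ∈ A, ∀ y ∈ A, w (x * y) = w x + w y) (hw₀ : w s₀ = 1)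
    (hw₁ : w s₁ = 1 ∨ w s₁ = -1) : ∃ D : Set G, IsPerfectCode (cayleyGraph S hone hinv) D := by
  -- With offset `3`, the weight changes from a vertex of `A` are `0, ±1, -3, -2`: all residues
  -- modulo five.
  refine ⟨_, isPerfectCode_of_weight (s := ![1, s₁, s₁⁻¹, t, t * s₀])
    (w := extendWeight A t w 3) rfl ?_ ?_⟩
  · subst hS
    ext u
    simp only [Matrix.range_cons, Matrix.range_empty, Set.union_empty, Set.singleton_union,
      Set.mem_insert_iff, Set.mem_singleton_iff]
  · intro v
    have hi := map_inv_of_map_mul_on hw hs₁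
    by_cases hv : v ∈ A
    · have : (fun i => extendWeight A t w 3 (![1, s₁, s₁⁻¹, t, t * s₀] i * v)) =
          fun i => ![0, w s₁, -w s₁, -3, 1 - 3] i + w v := by
        funext i
        fin_cases i
        · simp [extendWeight_mem hv]
        · simp [extendWeight_mem (A.mul_mem hs₁ hv), hw _ hs₁ _ hv]
        · simp [extendWeight_mem (A.mul_mem (A.inv_mem hs₁) hv), hw _ (A.inv_mem hs₁) _ hv, hi]
        · simp [hG.extendWeight_mul hv]
          ring
        · simp [mul_assoc, hG.extendWeight_mul (A.mul_mem hs₀ hv), hw _ hs₀ _ hv, hw₀]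
          ring
      rw [this]
      refine (add_left_injective (w v)).comp ?_
      rcases hw₁ with h | h <;> rw [h] <;> decide
    · obtain ⟨a, ha, rfl⟩ := hG.exists_eq_mul hv
      have hm := hG.mul_comm_inv hs₁
      have hm' := hG.mul_comm_inv (A.inv_mem hs₁)
      rw [inv_inv] at hm'
      have : (fun i => extendWeight A t w 3 (![1, s₁, s₁⁻¹, t, t * s₀] i * (t * a))) =
          fun i => ![0, -w s₁, w s₁, 3, 3 - 1] i + (w a - 3) := by
        funext i
        fin_cases i
        · simp [hG.extendWeight_mul ha]
        · simp [← mul_assoc, hm]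
          simp [mul_assoc, hG.extendWeight_mul (A.mul_mem (A.inv_mem hs₁) ha),
            hw _ (A.inv_mem hs₁) _ ha, hi]
          ring
        · simp [← mul_assoc, hm']
          simp [mul_assoc, hG.extendWeight_mul (A.mul_mem hs₁ ha), hw _ hs₁ _ ha]
          ring
        · simp [hG.mul_mul_cancel, extendWeight_mem ha]
        · simp [← mul_assoc, hG.conj s₀ hs₀]
          simp [extendWeight_mem (A.mul_mem (A.inv_mem hs₀) ha), hw _ (A.inv_mem hs₀) _ ha,
            map_inv_of_map_mul_on hw hs₀, hw₀]
          ring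
      rw [this]
      refine (add_left_injective (w a - 3)).comp ?_
      rcases hw₁ with h | h <;> rw [h] <;> decide

/-- Connection sets of the second family: multiplication by the connection set changes the weights
by distinct amounts. -/
theorem IsGeneralizedDihedral.exists_isPerfectCode_of_four_reflections
    (hG : IsGeneralizedDihedral A t) {S : Set G} {hone : (1 : G) ∉ S} {hinv : ∀ s ∈ S, s⁻¹ ∈ S}
    {s₀ s₁ s₂ : G} (hs₀ : s₀ ∈ A) (hs₁ : s₁ ∈ A) (hs₂ : s₂ ∈ A)
    (hS : S = {t, t * s₀, t * s₁, t * s₂}) {w : G → ZMod 5}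
    (hw : ∀ x ∈ A, ∀ y ∈ A, w (x * y) = w x + w y) {k : ZMod 5}
    (hk : Function.Injective ![k, 0, w s₀, w s₁, w s₂]) :
    ∃ D : Set G, IsPerfectCode (cayleyGraph S hone hinv) D := by
  refine ⟨_, isPerfectCode_of_weight (s := ![1, t, t * s₀, t * s₁, t * s₂])
    (w := extendWeight A t w k) rfl ?_ ?_⟩
  · subst hS
    ext u
    simp only [Matrix.range_cons, Matrix.range_empty, Set.union_empty, Set.singleton_union,
      Set.mem_insert_iff, Set.mem_singleton_iff]
  · intro v
    by_cases hv : v ∈ A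
    · have : (fun i => extendWeight A t w k (![1, t, t * s₀, t * s₁, t * s₂] i * v)) =
          fun i => ![k, 0, w s₀, w s₁, w s₂] i + (w v - k) := by
        have e : ∀ s ∈ A, extendWeight A t w k (t * s * v) = w s + (w v - k) := fun s hs => by
          rw [mul_assoc, hG.extendWeight_mul (A.mul_mem hs hv), hw _ hs _ hv]
          ring
        funext i
        fin_cases i
        · simp [extendWeight_mem hv]
        · simp [hG.extendWeight_mul hv]
        · exact e _ hs₀
        · exact e _ hs₁
        · exact e _ hs₂
      rw [this]
      exact (add_left_injective _).comp hk
    · obtain ⟨a, ha, rfl⟩ := hG.exists_eq_mul hv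
      have : (fun i => extendWeight A t w k (![1, t, t * s₀, t * s₁, t * s₂] i * (t * a))) =
          fun i => w a - ![k, 0, w s₀, w s₁, w s₂] i := by
        have e : ∀ s ∈ A, extendWeight A t w k (t * s * (t * a)) = w a - w s := fun s hs => by
          rw [← mul_assoc, hG.conj s hs, extendWeight_mem (A.mul_mem (A.inv_mem hs) ha),
            hw _ (A.inv_mem hs) _ ha, map_inv_of_map_mul_on hw hs]
          ring
        funext i
        fin_cases i
        · simp [hG.extendWeight_mul ha]
        · simp [hG.mul_mul_cancel, extendWeight_mem ha]
        · exact e _ hs₀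
        · exact e _ hs₁
        · exact e _ hs₂
      rw [this]
      exact (sub_right_injective (b := w a)).comp hk

theorem exists_isPerfectCode_of_firstFamily (hG : IsGeneralizedDihedral A t) {S : Set G}
    {hone : (1 : G) ∉ S} {hinv : ∀ s ∈ S, s⁻¹ ∈ S} (hconn : (cayleyGraph S hone hinv).Connected)
    (h : FirstFamily A t S) : ∃ D : Set G, IsPerfectCode (cayleyGraph S hone hinv) D := by
  obtain ⟨s₀, hs₀, s₁, hs₁, n, m, hS, rfl, hm, h5, u, -, -, ⟨v, rfl⟩, hu⟩ := h
  -- The identity serves as a third generator, of weight zero.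
  have hgen : A ≤ Subgroup.closure {s₀, s₁, 1} := by
    refine hG.le_of_connected hconn ?_ ?_
    · rw [Subgroup.closure_le]
      rintro x (rfl | rfl | rfl)
      exacts [hs₀, hs₁, A.one_mem]
    · have m₀ : s₀ ∈ Subgroup.closure {s₀, s₁, 1} := Subgroup.subset_closure (by simp)
      have m₁ : s₁ ∈ Subgroup.closure {s₀, s₁, 1} := Subgroup.subset_closure (by simp)
      subst hS
      rintro x (rfl | rfl | rfl | rfl)
      · exact Or.inl m₁
      · exact Or.inl (inv_mem m₁)
      · exact Or.inr (by rw [hG.mul_self]; exact one_mem _)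
      · exact Or.inr (by rwa [hG.mul_mul_cancel])
  have hrel : ∃ e : ℤ, (e = 1 ∨ e = -1) ∧
      ∀ i j k : ℤ, s₀ ^ i * s₁ ^ j * 1 ^ k = 1 → 5 ∣ i + e * j + 0 * k := by
    rcases hu with hu | hu
    · refine ⟨1, Or.inl rfl, fun i j k hijk => ?_⟩
      rw [one_zpow, mul_one] at hijk
      rw [zero_mul, add_zero]
      exact five_dvd_of_pow_eq hm h5 hu (by omega) hijk
    · refine ⟨-1, Or.inr rfl, fun i j k hijk => ?_⟩
      rw [one_zpow, mul_one] at hijk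
      rw [zero_mul, add_zero]
      exact five_dvd_of_pow_eq hm h5 hu (by omega) hijk
  obtain ⟨e, he, hrel⟩ := hrel
  obtain ⟨w, hw, hw₀, hw₁, -⟩ := hG.exists_weight hs₀ hs₁ A.one_mem hgen hrel
  refine hG.exists_isPerfectCode_of_inverse_pair hs₀ hs₁ hS hw hw₀ ?_
  rcases he with rfl | rfl
  · exact Or.inl (by simpa using hw₁)
  · exact Or.inr (by simpa using hw₁)

/-- The residues `0, 1, -a, -b` are distinct, and the one they miss is `v`, which serves as offset.
-/
theorem exists_injective_of_pair_eq {v a b : ℤ} (hv : v ∈ ({2, 3, 4} : Set ℤ))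
    (hab : ({a, b} : Set ℤ) = {2 + parity v, v - parity v - 1}) :
    ∃ k : ZMod 5, Function.Injective ![k, 0, 1, ((-a : ℤ) : ZMod 5), ((-b : ℤ) : ZMod 5)] := by
  have h2 : parity 2 = 0 := by decide
  have h3 : parity 3 = 1 := by decide
  have h4 : parity 4 = 0 := by decide
  rcases hv with rfl | rfl | rfl
  · rw [h2, Set.pair_eq_pair_iff] at hab
    rcases hab with ⟨rfl, rfl⟩ | ⟨rfl, rfl⟩
    · exact ⟨2, by decide⟩
    · exact ⟨2, by decide⟩
  · rw [h3, Set.pair_eq_pair_iff] at hab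
    rcases hab with ⟨rfl, rfl⟩ | ⟨rfl, rfl⟩
    · exact ⟨3, by decide⟩
    · exact ⟨3, by decide⟩
  · rw [h4, Set.pair_eq_pair_iff] at hab
    rcases hab with ⟨rfl, rfl⟩ | ⟨rfl, rfl⟩
    · exact ⟨4, by decide⟩
    · exact ⟨4, by decide⟩

theorem exists_isPerfectCode_of_secondFamily (hG : IsGeneralizedDihedral A t) {S : Set G}
    {hone : (1 : G) ∉ S} {hinv : ∀ s ∈ S, s⁻¹ ∈ S} (hconn : (cayleyGraph S hone hinv).Connected)
    (h : SecondFamily A t S) : ∃ D : Set G, IsPerfectCode (cayleyGraph S hone hinv) D := by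
  obtain ⟨s₀, hs₀, s₁, hs₁, s₂, hs₂, n, m, l, hS, rfl, hm, hl, h5, v, hv, a, b, hab, α₁, α₂, j,
    -, -, -, h₁, h₂⟩ := h
  have hgen : A ≤ Subgroup.closure {s₀, s₁, s₂} := by
    refine hG.le_of_connected hconn ?_ ?_
    · rw [Subgroup.closure_le]
      rintro x (rfl | rfl | rfl)
      exacts [hs₀, hs₁, hs₂]
    · subst hS
      rintro x (rfl | rfl | rfl | rfl)
      · exact Or.inr (by rw [hG.mul_self]; exact one_mem _)
      all_goals
        refine Or.inr ?_
        rw [hG.mul_mul_cancel]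
        exact Subgroup.subset_closure (by simp)
  obtain ⟨w, hw, hw₀, hw₁, hw₂⟩ := hG.exists_weight hs₀ hs₁ hs₂ hgen (a := -a) (b := -b)
    fun i j' k hrel => five_dvd_of_pow_eq_mul (hG.comm _ hs₀ _ hs₁) hm hl h5 h₁ ⟨α₁, by ring⟩ h₂
      ⟨α₂, by ring⟩ hrel
  obtain ⟨k, hk⟩ := exists_injective_of_pair_eq hv hab
  exact hG.exists_isPerfectCode_of_four_reflections hs₀ hs₁ hs₂ hS hw (k := k)
    (by rwa [hw₀, hw₁, hw₂])

end Converse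

/-! ### Classification of connection sets with a perfect code -/

section Forward

variable {G : Type*} [Group G] {A : Subgroup G} {t : G}

theorem mul_self_of_inv_eq {z : G} (h : z⁻¹ = z) : z * z = 1 := by
  nth_rw 2 [← h]
  exact mul_inv_cancel z

/-- A connection set with a perfect code either consists of reflections, and then belongs to the
second family, or contains exactly two elements of `A`, and then belongs to the first one. -/
theorem IsGeneralizedDihedral.family_of_indicator [Finite G] (hG : IsGeneralizedDihedral A t)
    {S : Set G} (hinv : ∀ s ∈ S, s⁻¹ ∈ S) {p q r : G} (hS : S = {t, p, q, r}) (hpq : p ≠ q)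
    (hpr : p ≠ r) (hqr : q ≠ r) {χ : G → ℕ} (h1 : χ 1 = 1)
    (h : ∀ g, χ g + χ (t * g) + χ (p * g) + χ (q * g) + χ (r * g) = 1) :
    FirstFamily A t S ∨ SecondFamily A t S := by
  have ht₂ := hG.mul_self
  have hcases : ∀ s ∈ S, s ∈ A → (s⁻¹ = p ∧ p ∈ A) ∨ (s⁻¹ = q ∧ q ∈ A) ∨ (s⁻¹ = r ∧ r ∈ A) := by
    intro s hs hsA
    have h₁ := hinv s hs
    have h₂ := A.inv_mem hsA
    rw [hS] at h₁
    rcases h₁ with h₁ | h₁ | h₁ | h₁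
    · exact absurd (h₁ ▸ h₂) hG.not_mem
    · exact Or.inl ⟨h₁, h₁ ▸ h₂⟩
    · exact Or.inr (Or.inl ⟨h₁, h₁ ▸ h₂⟩)
    · exact Or.inr (Or.inr ⟨h₁, h₁ ▸ h₂⟩)
  -- two elements of `A` and two reflections
  have two : ∀ x y z : G, x ∈ A → y ∈ A → z ∉ A → S = {t, x, y, z} →
      (∀ g, χ g + χ (t * g) + χ (x * g) + χ (y * g) + χ (z * g) = 1) → FirstFamily A t S := by
    intro x y z hx hy hz hS h
    have hmem : ∀ u ∈ A, u ∈ S → u = x ∨ u = y := by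
      intro u hu huS
      rw [hS] at huS
      rcases huS with rfl | rfl | rfl | rfl
      exacts [absurd hu hG.not_mem, Or.inl rfl, Or.inr rfl, absurd hu hz]
    by_cases hxy : x⁻¹ = y
    · subst hxy
      obtain ⟨s₀, hs₀, rfl⟩ := hG.exists_eq_mul hz
      refine firstFamily_of_relations hs₀ hx ?_ (hG.five_dvd_of_inverse_pair hs₀ hx h1
        fun g => by have := h g; omega)
      rw [hS]
      ext u
      simp only [Set.mem_insert_iff, Set.mem_singleton_iff]
      tauto
    · have hxx := (hmem _ (A.inv_mem hx) (hinv x (by simp [hS]))).resolve_right hxy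
      have hyy := (hmem _ (A.inv_mem hy) (hinv y (by simp [hS]))).resolve_left
        fun h' => hxy (by rw [← h', inv_inv])
      exact (not_indicator_of_central_involutions (x := t) (y := z) (z := x) (w := y) h1
        (fun g => by have := h g; omega) ht₂ (hG.mul_self_of_notMem hz) (mul_self_of_inv_eq hxx)
        (mul_self_of_inv_eq hyy) (hG.commute_of_inv_eq hx hxx)
        (hG.commute_of_inv_eq hy hyy)).elim
  -- three elements of `A`, two of which are mutually inverse
  have pair : ∀ x y z : G, x ∈ A → z ∈ A → z⁻¹ = z → x⁻¹ = y →
      (∀ g, χ g + χ (t * g) + χ (x * g) + χ (y * g) + χ (z * g) = 1) → False := by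
    rintro x y z hx hz hz' rfl h
    exact hG.not_indicator_of_inverse_pair (x := t) (z := z) (s := x) h1
      (fun g => by have := h g; omega) ht₂ (mul_self_of_inv_eq hz') (hG.commute_of_inv_eq hz hz') hx
  -- one element of `A`
  have one : ∀ x y z : G, x ∈ A → y ∉ A → z ∉ A → x⁻¹ = x →
      (∀ g, χ g + χ (t * g) + χ (x * g) + χ (y * g) + χ (z * g) = 1) → False := by
    intro x y z hx hy hz hx' h
    exact hG.not_indicator_of_three_reflections (a := t) (b := y) (c := z) (z := x) h1
      (fun g => by have := h g; omega) hG.not_mem hy hz hx hx'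
  have cp := hcases p (by simp [hS])
  have cq := hcases q (by simp [hS])
  have cr := hcases r (by simp [hS])
  by_cases hp : p ∈ A <;> by_cases hq : q ∈ A <;> by_cases hr : r ∈ A <;>
    simp only [hp, hq, hr, and_true, and_false, or_false, false_or, forall_true_left] at cp cq cr
  -- Inversion permutes `p, q, r`: it either fixes all three or swaps two of them and fixes the
  -- third.
  · have inv_eq : ∀ {x y : G}, x⁻¹ = y → y⁻¹ = x := fun e => by rw [← e, inv_inv]
    exfalso
    rcases cp with cp | cp | cp
    · have cq' := cq.resolve_left fun e => hpq (cp.symm.trans (inv_eq e))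
      rcases cq' with cq' | cq'
      · have cr' := (cr.resolve_left fun e => hpr (cp.symm.trans (inv_eq e))).resolve_left
          fun e => hqr (cq'.symm.trans (inv_eq e))
        exact not_indicator_of_central_involutions h1 h ht₂ (mul_self_of_inv_eq cp)
          (mul_self_of_inv_eq cq') (mul_self_of_inv_eq cr') (hG.commute_of_inv_eq hq cq')
          (hG.commute_of_inv_eq hr cr')
      · exact pair q r p hq hp cp cq' fun g => by have := h g; omega
    · have cr' := (cr.resolve_left fun e => hqr (cp.symm.trans (inv_eq e))).resolve_left
        fun e => hpr ((inv_eq cp).symm.trans (inv_eq e))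
      exact pair p q r hp hr cr' cp h
    · have cq' := (cq.resolve_left fun e => hqr.symm (cp.symm.trans (inv_eq e))).resolve_right
        fun e => hpq ((inv_eq cp).symm.trans (inv_eq e))
      exact pair p r q hp hq cq' cp fun g => by have := h g; omega
  · exact Or.inl (two p q r hp hq hr hS h)
  · exact Or.inl (two p r q hp hr hq (by rw [hS, Set.pair_comm q r]) fun g => by
      have := h g; omega)
  · exact (one p q r hp hq hr cp h).elim
  · exact Or.inl (two q r p hq hr hp (by rw [hS, Set.insert_comm p q, Set.pair_comm p r])
      fun g => by have := h g; omega)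
  · exact (one q p r hq hp hr cq fun g => by have := h g; omega).elim
  · exact (one r p q hr hp hq cr fun g => by have := h g; omega).elim
  · obtain ⟨x, hx, rfl⟩ := hG.exists_eq_mul hp
    obtain ⟨y, hy, rfl⟩ := hG.exists_eq_mul hq
    obtain ⟨z, hz, rfl⟩ := hG.exists_eq_mul hr
    right
    -- In each case the elements are renamed so that `s₁, s₂, s₀` have weights `2, 3, 1`.
    rcases hG.five_dvd_of_four_reflections hx hy hz h1 h with k | k | k | k | k | k
    · exact secondFamily_of_relations hG hz hx hy (by rw [hS]; ext; simp; tauto) k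
    · exact secondFamily_of_relations hG hy hx hz (by rw [hS]; ext; simp; tauto) k
    · exact secondFamily_of_relations hG hz hy hx (by rw [hS]; ext; simp; tauto) k
    · exact secondFamily_of_relations hG hx hy hz (by rw [hS]) k
    · exact secondFamily_of_relations hG hy hz hx (by rw [hS]; ext; simp; tauto) k
    · exact secondFamily_of_relations hG hx hz hy (by rw [hS]; ext; simp; tauto) k

end Forward

theorem theorem1p1 {G : Type*} [Group G] [Finite G] (A : Subgroup G) (t : G)
    (hG : IsGeneralizedDihedral A t) (S : Set G) (hone : (1 : G) ∉ S)
    (hinv : ∀ s ∈ S, s⁻¹ ∈ S) (hcard : S.ncard = 4)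
    (hconn : (cayleyGraph S hone hinv).Connected) (ht : t ∈ S) :
    (∃ D : Set G, IsPerfectCode (cayleyGraph S hone hinv) D) ↔
      FirstFamily A t S ∨ SecondFamily A t S := by
  constructor
  · rintro ⟨D, hD⟩
    have h3 : (S \ {t}).ncard = 3 := by rw [Set.ncard_sdiff_singleton_of_mem ht, hcard]
    obtain ⟨p, q, r, hpq, hpr, hqr, hset⟩ := Set.ncard_eq_three.mp h3
    have hS : S = {t, p, q, r} := by rw [← hset, Set.insert_sdiff_singleton, Set.insert_eq_of_mem ht]
    have hne : ∀ x ∈ ({p, q, r} : Set G), t ≠ x := by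
      rintro x hx rfl
      rw [← hset] at hx
      exact hx.2 rfl
    obtain ⟨χ, h1, h⟩ := exists_indicator_of_isPerfectCode hD hS (hne p (by simp))
      (hne q (by simp)) (hne r (by simp)) hpq hpr hqr
    exact hG.family_of_indicator hinv hS hpq hpr hqr h1 h
  · rintro (h | h)
    · exact exists_isPerfectCode_of_firstFamily hG hconn h
    · exact exists_isPerfectCode_of_secondFamily hG hconn h
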